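/- Let $R=\bigoplus_{n\ge 0}R_n$ be a commutative Noetherian graded ring whose degree-zero part $R_0$ is a Noetherian local ring, and suppose that $R$ is generated as an $R_0$-algebra by finitely many elements of $R_1$. Let $\mathfrak a_0\subsetneq R_0$ be a proper ideal, $R_+=\bigoplus_{n>0}R_n$ and $\mathfrak a=\mathfrak a_0R+R_+$. Let $M=\bigoplus_{n\in\mathbb Z}M_n$ be a non-zero finitely generated graded $R$-module. For $i\ge 0$ let $H^i_{\mathfrak a}(M)$ be the $i$-th local cohomology module with its natural grading, that is, the $i$-th cohomology of the Čech complex of $M$ on any finite system of homogeneous generators of $\mathfrak a$, and let $H^i_{\mathfrak a}(M)_n$ be its component of degree $n\in\mathbb Z$. Let $f^{R_+}_{\mathfrak a}(M)\in\mathbb N_0\cup\{\infty\}$ be the least $i\ge 0$ such that $R_+\not\subseteq\sqrt{(0:_R H^i_{\mathfrak a}(M))}$, with $f^{R_+}_{\mathfrak a}(M)=\infty$ if there is no such $i$. If $f=f^{R_+}_{\mathfrak a}(M)<\infty$, then there is $n_0\in\mathbb Z$ such that $H^{f}_{\mathfrak a}(M)_n\ne 0$ for all $n\le n_0$. Moreover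 $$f^{R_+}_{\mathfrak a}(M)=\inf\{\,i\ge 0 : H^i_{\mathfrak a}(M)_n\neq 0\ \text{for all } n\ll 0\,\},$$ where $\inf\emptyset=\infty$. -/

import Mathlib

open scoped DirectSum

noncomputable section

/-- Compatibility of a `ℤ`-grading `ℳ` of an `R`-module with an `ℕ`-grading `𝒜` of the ring `R`:
`R_i • M_n ⊆ M_{i+n}`. -/
class GradedAction {R M : Type*} [CommRing R] [AddCommGroup M] [Module R M]
    (𝒜 : ℕ → AddSubgroup R) (ℳ : ℤ → AddSubgroup M) : Prop where
  smul_mem : ∀ {i : ℕ} {n : ℤ} {r : R} {m : M}, r ∈ 𝒜 i → m ∈ ℳ n → r • m ∈ ℳ ((i : ℤ) + n)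

/-- The ideal `𝔞 = 𝔞₀ R + R₊`. -/
def idealAddIrrelevant {R : Type*} [CommRing R] (𝒜 : ℕ → AddSubgroup R) [GradedRing 𝒜]
    (a₀ : Ideal (𝒜 0)) : Ideal R :=
  a₀.map (algebraMap (𝒜 0) R) ⊔ (HomogeneousIdeal.irrelevant 𝒜).toIdeal

/-- A finite system of homogeneous generators of an ideal. -/
structure IsHomogeneousGenerators {R : Type*} [CommRing R] (𝒜 : ℕ → AddSubgroup R)
    {r : ℕ} (x : Fin r → R) (J : Ideal R) : Prop where
  homogeneous : ∀ i, SetLike.IsHomogeneousElem 𝒜 (x i)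
  span_eq : Ideal.span (Set.range x) = J

/-! Local cohomology of `M` with support in the ideal generated by `x₁, …, x_r`, as the cohomology
of the Čech complex `0 → M → ⨁ᵢ M_{xᵢ} → ⨁_{i<j} M_{xᵢxⱼ} → ⋯ → M_{x₁⋯x_r} → 0`.
For homogeneous `xᵢ` and graded `M` this is a complex of graded modules with differentials of
degree zero, which yields the grading of the local cohomology modules. -/

namespace Cech

section Module

variable {R : Type*} [CommRing R] {r : ℕ} (x : Fin r → R)

/-- The multiplicative set generated by the `xᵢ`, `i ∈ I`; inverting it amounts to inverting
`∏ i ∈ I, xᵢ`. -/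
def denom (I : Finset (Fin r)) : Submonoid R :=
  Submonoid.closure (x '' (I : Set (Fin r)))

lemma denom_mono {I J : Finset (Fin r)} (h : I ⊆ J) : denom x I ≤ denom x J :=
  Submonoid.closure_mono (Set.image_mono (Finset.coe_subset.mpr h))

variable (M : Type*) [AddCommGroup M] [Module R M]

/-- The total Čech module `∏_I M_{x_I}`, over all sets `I` of indices. -/
abbrev Total : Type _ :=
  (I : Finset (Fin r)) → LocalizedModule (denom x I) M

/-- The localization map `M_{x_I} → M_{x_J}` for `I ⊆ J`. -/
def res {I J : Finset (Fin r)} (h : I ⊆ J) :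
    LocalizedModule (denom x I) M →ₗ[R] LocalizedModule (denom x J) M :=
  LocalizedModule.liftOfLE (denom x I) (denom x J) (denom_mono x h)

/-- The sign `(-1)^k`, where `j` is the `k`-th element (counted from `0`) of `J`. -/
def sign (R : Type*) [CommRing R] {r : ℕ} (J : Finset (Fin r)) (j : Fin r) : R :=
  (-1) ^ (J.filter (· < j)).card

/-- The Čech differential `(d c)_J = ∑_{j ∈ J} ± c_{J ∖ {j}}|_J`. -/
def d : Total x M →ₗ[R] Total x M :=
  LinearMap.pi fun J ↦ ∑ j ∈ J, sign R J j •
    (res x M (J.erase_subset j)).comp (LinearMap.proj (J.erase j))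

/-- The Čech cochains of degree `p`: those supported on the index sets with `p` elements. -/
def cochains (p : ℕ) : Submodule R (Total x M) where
  carrier := {c | ∀ I, I.card ≠ p → c I = 0}
  zero_mem' := fun _ _ ↦ rfl
  add_mem' := fun ha hb I hI ↦ by simp [ha I hI, hb I hI]
  smul_mem' := fun t a ha I hI ↦ by simp [ha I hI]

/-- The Čech cocycles of degree `p`. -/
def cocycles (p : ℕ) : Submodule R (Total x M) :=
  cochains x M p ⊓ LinearMap.ker (d x M)

/-- The Čech coboundaries of degree `p`; there are none but `0` in degree `0`. -/
def coboundaries : ℕ → Submodule R (Total x M)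
  | 0 => ⊥
  | p + 1 => (cochains x M p).map (d x M)

lemma res_res {I J K : Finset (Fin r)} (h : I ⊆ J) (h' : J ⊆ K)
    (z : LocalizedModule (denom x I) M) :
    res x M h' (res x M h z) = res x M (h.trans h') z := by
  induction z using LocalizedModule.induction_on with
  | _ m s =>
    simp only [res, IsLocalizedModule.mk_eq_mk', IsLocalizedModule.liftOfLE_mk']

lemma sign_mul_sign {J : Finset (Fin r)} {j k : Fin r} (hj : j ∈ J) (h : j < k) :
    sign R J j * sign R (J.erase j) k + sign R J k * sign R (J.erase k) j = 0 := by
  have h₁ : (J.erase k).filter (· < j) = J.filter (· < j) := by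
    ext i; simp only [Finset.mem_filter, Finset.mem_erase]; grind
  have h₂ : J.filter (· < k) = insert j ((J.erase j).filter (· < k)) := by
    ext i; simp only [Finset.mem_filter, Finset.mem_erase, Finset.mem_insert]; grind
  rw [sign, sign, sign, sign, h₁, h₂, Finset.card_insert_of_notMem (by simp), pow_succ]
  ring

lemma d_d (c : Total x M) : d x M (d x M c) = 0 := by
  funext J
  have hd : ∀ (c : Total x M) (J : Finset (Fin r)), d x M c J =
      ∑ j ∈ J, sign R J j • res x M (J.erase_subset j) (c (J.erase j)) := by
    intro c J
    simp [d]
  have hc : ∀ {I I' : Finset (Fin r)} (e : I = I') (h : I ⊆ J) (h' : I' ⊆ J),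
      res x M h (c I) = res x M h' (c I') := by
    rintro I _ rfl _ _
    rfl
  rw [hd]
  simp only [hd, map_sum, map_smul, res_res, Finset.smul_sum, smul_smul]
  rw [Finset.sum_sigma']
  refine Finset.sum_involution (fun a _ ↦ ⟨a.2, a.1⟩) ?_ ?_ ?_ ?_
  · rintro ⟨j, k⟩ h
    simp only [Finset.mem_sigma, Finset.mem_erase] at h
    obtain ⟨hj, hkj, hk⟩ := h
    rw [hc (Finset.erase_right_comm (a := k) (b := j)) _
      ((Finset.erase_subset _ _).trans (Finset.erase_subset _ _)), ← add_smul]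
    rcases lt_or_gt_of_ne hkj with h | h
    · rw [add_comm, sign_mul_sign hk h, zero_smul]
    · rw [sign_mul_sign hj h, zero_smul]
  · rintro ⟨j, k⟩ h _ e
    simp only [Finset.mem_sigma, Finset.mem_erase] at h
    exact h.2.1 (congrArg Sigma.fst e)
  · rintro ⟨j, k⟩ h
    simp only [Finset.mem_sigma, Finset.mem_erase] at h ⊢
    exact ⟨h.2.2, fun e ↦ h.2.1 e.symm, h.1⟩
  · rintro ⟨j, k⟩ _
    rfl

/-- The `p`-th local cohomology module of `M` with support in the ideal generated by the `xᵢ`. -/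
abbrev H (p : ℕ) : Type _ :=
  cocycles x M p ⧸ (coboundaries x M p).submoduleOf (cocycles x M p)

end Module

section Graded

variable {R : Type*} [CommRing R] {r : ℕ} (x : Fin r → R)
  {M : Type*} [AddCommGroup M] [Module R M]
  (𝒜 : ℕ → AddSubgroup R) [GradedRing 𝒜] (ℳ : ℤ → AddSubgroup M) [GradedAction 𝒜 ℳ]

/-- The component of degree `n` of a homogeneous localization `S⁻¹M`: the fractions `m / s` with
`s ∈ S` homogeneous of degree `e` and `m` homogeneous of degree `e + n`. -/
def locComponent (S : Submonoid R) (n : ℤ) : AddSubgroup (LocalizedModule S M) where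
  carrier := {z | ∃ (e : ℕ) (m : M) (s : S), (s : R) ∈ 𝒜 e ∧ m ∈ ℳ ((e : ℤ) + n) ∧
    z = LocalizedModule.mk m s}
  zero_mem' := ⟨0, 0, 1, SetLike.GradedOne.one_mem, zero_mem _, (LocalizedModule.zero_mk 1).symm⟩
  add_mem' := by
    rintro _ _ ⟨e, m, s, hs, hm, rfl⟩ ⟨e', m', s', hs', hm', rfl⟩
    refine ⟨e + e', s' • m + s • m', s * s', SetLike.GradedMul.mul_mem hs hs',
      add_mem ?_ ?_, LocalizedModule.mk_add_mk⟩
    · have h := GradedAction.smul_mem (ℳ := ℳ) hs' hm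
      rwa [show (e' : ℤ) + (e + n) = ((e + e' : ℕ) : ℤ) + n by push_cast; ring] at h
    · have h := GradedAction.smul_mem (ℳ := ℳ) hs hm'
      rwa [show (e : ℤ) + (e' + n) = ((e + e' : ℕ) : ℤ) + n by push_cast; ring] at h
  neg_mem' := by
    rintro _ ⟨e, m, s, hs, hm, rfl⟩
    exact ⟨e, -m, s, hs, neg_mem hm, LocalizedModule.mk_neg.symm⟩

/-- The component of degree `n` of the total Čech module. -/
def totalComponent (n : ℤ) : AddSubgroup (Total x M) :=
  AddSubgroup.pi Set.univ fun I ↦ locComponent 𝒜 ℳ (denom x I) n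

/-- The component of degree `n` of the `p`-th local cohomology module: the classes of the
cocycles that are homogeneous of degree `n`. -/
def component (p : ℕ) (n : ℤ) : AddSubgroup (H x M p) :=
  ((totalComponent x 𝒜 ℳ n).comap (cocycles x M p).subtype.toAddMonoidHom).map
    ((coboundaries x M p).submoduleOf (cocycles x M p)).mkQ.toAddMonoidHom

end Graded

/-- The finiteness dimension `f^{R₊}_𝔞(M)` of `M` relative to `R₊`, for `𝔞` generated by the `xᵢ`:
the least `i` such that `R₊` is not contained in the radical of the annihilator of `H^i_𝔞(M)`,
and `∞` if there is no such `i`. -/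
def relFinitenessDim {R : Type*} [CommRing R] {r : ℕ} (x : Fin r → R)
    (M : Type*) [AddCommGroup M] [Module R M] (𝒜 : ℕ → AddSubgroup R) [GradedRing 𝒜] : ℕ∞ :=
  ⨅ i ∈ {i : ℕ | ¬ (HomogeneousIdeal.irrelevant 𝒜).toIdeal ≤
    (Module.annihilator R (H x M i)).radical}, (i : ℕ∞)

end Cech

end

/-!
Since `R₊ ⊆ √𝔞`, the component `H^i_𝔞(M)_n` vanishes for `n ≫ 0`. Let `g` be the least level at
which `H^g_𝔞(M)_n ≠ 0` for arbitrarily small `n`. By induction on `g`, through the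
kernel and cokernel of `M → ∏ₖ M(1)`, `m ↦ (yₖ m)ₖ`, where the `yₖ ∈ R₁` generate `R₊`, no nonzero
class of `H^g_𝔞(M)` of sufficiently small degree is killed by all `yₖ`. A nonzero class of very
small degree can therefore be multiplied by one `yₖ` after another and stays nonzero up to a fixed
degree: `H^g_𝔞(M)_n ≠ 0` for all small `n`, and no power of `R₊` annihilates `H^g_𝔞(M)`. Below `g`
every `H^i_𝔞(M)` is concentrated in finitely many degrees, so that `R₊` is nilpotent on it.
-/

/-! ### Gradings -/

section Gradings

variable {ι : Type*} [DecidableEq ι] {M N : Type*} [AddCommGroup M] [AddCommGroup N]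

lemma isInternal_of_forall_sum (ℳ : ι → AddSubgroup M)
    (indep : ∀ (F : Finset ι) (f : ι → M), (∀ n, f n ∈ ℳ n) → ∑ n ∈ F, f n = 0 →
      ∀ n ∈ F, f n = 0)
    (span : ∀ m, ∃ (F : Finset ι) (f : ι → M), (∀ n, f n ∈ ℳ n) ∧ ∑ n ∈ F, f n = m) :
    DirectSum.IsInternal ℳ := by
  classical
  constructor
  · rw [injective_iff_map_eq_zero]
    intro a ha
    rw [DirectSum.coeAddMonoidHom_eq_dfinsuppSum, DFinsupp.sum] at ha
    ext n
    by_cases hn : n ∈ DFinsupp.support a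
    · simpa using indep _ (fun n ↦ (a n : M)) (fun n ↦ (a n).2) ha n hn
    · simpa using hn
  · intro m
    obtain ⟨F, f, hf, rfl⟩ := span m
    exact ⟨∑ n ∈ F, DirectSum.of (fun n ↦ ℳ n) n ⟨f n, hf n⟩, by simp⟩

section Component

variable (ℳ : ι → AddSubgroup M) [DirectSum.Decomposition ℳ]
  (𝒩 : ι → AddSubgroup N) [DirectSum.Decomposition 𝒩]

/-- The projection of a graded group to its component of degree `n`, as an endomorphism. -/
noncomputable def homogComponent (n : ι) : M →+ M where
  toFun m := (DirectSum.decompose ℳ m n : M)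
  map_zero' := by simp
  map_add' a b := by simp

lemma homogComponent_mem (n : ι) (m : M) : homogComponent ℳ n m ∈ ℳ n :=
  (DirectSum.decompose ℳ m n).2

variable {ℳ}

lemma homogComponent_of_mem {n : ι} {m : M} (h : m ∈ ℳ n) : homogComponent ℳ n m = m :=
  DirectSum.decompose_of_mem_same ℳ h

lemma homogComponent_of_mem_ne {n k : ι} {m : M} (h : m ∈ ℳ n) (hk : n ≠ k) :
    homogComponent ℳ k m = 0 :=
  DirectSum.decompose_of_mem_ne ℳ h hk

lemma homogComponent_sum_of_mem {F : Finset ι} {f : ι → M} (hf : ∀ n ∈ F, f n ∈ ℳ n) {k : ι}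
    (hk : k ∈ F) : homogComponent ℳ k (∑ n ∈ F, f n) = f k := by
  rw [map_sum, Finset.sum_eq_single_of_mem k hk
    fun n hn hnk ↦ homogComponent_of_mem_ne (hf n hn) hnk, homogComponent_of_mem (hf k hk)]

variable (ℳ)

lemma exists_sum_homogComponent (m : M) :
    ∃ F : Finset ι, (∀ n ∉ F, homogComponent ℳ n m = 0) ∧
      ∑ n ∈ F, homogComponent ℳ n m = m := by
  classical
  refine ⟨DFinsupp.support (DirectSum.decompose ℳ m), fun n hn ↦ ?_,
    DirectSum.sum_support_decompose ℳ m⟩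
  simpa [homogComponent] using hn

lemma map_homogComponent (φ : M →+ N) {σ : ι → ι} (hσ : Function.Injective σ)
    (h : ∀ n, ∀ m ∈ ℳ n, φ m ∈ 𝒩 (σ n)) (n : ι) (m : M) :
    φ (homogComponent ℳ n m) = homogComponent 𝒩 (σ n) (φ m) := by
  induction m using DirectSum.Decomposition.inductionOn ℳ with
  | zero => simp
  | @homogeneous i m =>
    by_cases hi : i = n
    · subst hi
      rw [homogComponent_of_mem m.2, homogComponent_of_mem (h _ _ m.2)]
    · rw [homogComponent_of_mem_ne m.2 hi, homogComponent_of_mem_ne (h _ _ m.2) (hσ.ne hi),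
        map_zero]
  | add a b ha hb => simp [ha, hb]

end Component

/-- The grading of the twist `M(d)`. -/
def shiftGrading [Add ι] (ℳ : ι → AddSubgroup M) (d n : ι) : AddSubgroup M := ℳ (d + n)

lemma isInternal_shiftGrading [AddGroup ι] (ℳ : ι → AddSubgroup M) [DirectSum.Decomposition ℳ]
    (d : ι) : DirectSum.IsInternal (shiftGrading ℳ d) := by
  refine isInternal_of_forall_sum _ (fun F f hf h k hk ↦ ?_) fun m ↦ ?_
  · have hfk : homogComponent ℳ (d + k) (∑ n ∈ F, f n) = f k := by
      rw [map_sum, Finset.sum_eq_single_of_mem k hk fun n _ hnk ↦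
        homogComponent_of_mem_ne (ℳ := ℳ) (hf n) (by simpa using hnk),
        homogComponent_of_mem (ℳ := ℳ) (hf k)]
    rw [← hfk, h, map_zero]
  · obtain ⟨F, -, hF⟩ := exists_sum_homogComponent ℳ m
    exact ⟨F.map (Equiv.addLeft (-d)).toEmbedding, fun n ↦ homogComponent ℳ (d + n) m,
      fun n ↦ homogComponent_mem ℳ _ m, by simpa using hF⟩

noncomputable instance [AddGroup ι] (ℳ : ι → AddSubgroup M) [DirectSum.Decomposition ℳ] (d : ι) :
    DirectSum.Decomposition (shiftGrading ℳ d) :=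
  (isInternal_shiftGrading ℳ d).chooseDecomposition

section Pi

variable {κ : Type*} {P : κ → Type*} [∀ k, AddCommGroup (P k)]

/-- The componentwise grading of a product of graded groups. -/
def piGrading (𝒢 : ∀ k, ι → AddSubgroup (P k)) (n : ι) : AddSubgroup (∀ k, P k) :=
  AddSubgroup.pi Set.univ fun k ↦ 𝒢 k n

omit [DecidableEq ι] in
lemma mem_piGrading {𝒢 : ∀ k, ι → AddSubgroup (P k)} {n : ι} {f : ∀ k, P k} :
    f ∈ piGrading 𝒢 n ↔ ∀ k, f k ∈ 𝒢 k n := by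
  simp [piGrading, AddSubgroup.mem_pi]

variable [Finite κ] (𝒢 : ∀ k, ι → AddSubgroup (P k)) [∀ k, DirectSum.Decomposition (𝒢 k)]

lemma isInternal_piGrading : DirectSum.IsInternal (piGrading 𝒢) := by
  classical
  have := Fintype.ofFinite κ
  refine isInternal_of_forall_sum _ (fun F f hf h n hn ↦ funext fun k ↦ ?_) fun m ↦ ?_
  · rw [← homogComponent_sum_of_mem (ℳ := 𝒢 k) (fun n _ ↦ mem_piGrading.1 (hf n) k) hn,
      ← Finset.sum_apply, h, Pi.zero_apply, map_zero]
  · choose F hF hFs using fun k ↦ exists_sum_homogComponent (𝒢 k) (m k)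
    refine ⟨Finset.univ.biUnion F, fun n k ↦ homogComponent (𝒢 k) n (m k),
      fun n ↦ mem_piGrading.2 fun k ↦ homogComponent_mem _ _ _, funext fun k ↦ ?_⟩
    rw [Finset.sum_apply]
    conv_rhs => rw [← hFs k]
    exact (Finset.sum_subset (Finset.subset_biUnion_of_mem F (Finset.mem_univ k))
      fun n _ hn ↦ hF k n hn).symm

noncomputable instance : DirectSum.Decomposition (piGrading 𝒢) :=
  (isInternal_piGrading 𝒢).chooseDecomposition

end Pi

end Gradings

section GradedModules

variable {ι : Type*} [DecidableEq ι] {R : Type*} [CommRing R]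
  {M N : Type*} [AddCommGroup M] [AddCommGroup N] [Module R M] [Module R N]

section SubQuot

variable (ℳ : ι → AddSubgroup M) (P : Submodule R M)

/-- The grading induced on a submodule. -/
def subGrading (n : ι) : AddSubgroup P :=
  (ℳ n).comap P.subtype.toAddMonoidHom

/-- The grading induced on a quotient module. -/
def quotGrading (n : ι) : AddSubgroup (M ⧸ P) :=
  (ℳ n).map P.mkQ.toAddMonoidHom

variable [DirectSum.Decomposition ℳ] {P}

lemma isInternal_subGrading (hP : P.IsHomogeneous ℳ) :
    DirectSum.IsInternal (subGrading ℳ P) := by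
  refine isInternal_of_forall_sum _ (fun F f hf h n hn ↦ Subtype.ext ?_) fun m ↦ ?_
  · rw [← homogComponent_sum_of_mem (ℳ := ℳ) (f := fun n ↦ (f n : M)) (fun n _ ↦ hf n) hn,
      ← AddSubmonoidClass.coe_finsetSum, h, ZeroMemClass.coe_zero, map_zero]
  · obtain ⟨F, -, hF⟩ := exists_sum_homogComponent ℳ (m : M)
    exact ⟨F, fun n ↦ ⟨homogComponent ℳ n m, hP n m.2⟩,
      fun n ↦ homogComponent_mem ℳ n _, Subtype.ext (by simpa using hF)⟩

lemma isInternal_quotGrading (hP : P.IsHomogeneous ℳ) :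
    DirectSum.IsInternal (quotGrading ℳ P) := by
  refine isInternal_of_forall_sum _ (fun F f hf h n hn ↦ ?_) fun m ↦ ?_
  · choose g hg hgf using hf
    obtain rfl : (fun n ↦ P.mkQ (g n)) = f := funext hgf
    rw [← map_sum, Submodule.mkQ_apply, Submodule.Quotient.mk_eq_zero] at h
    change P.mkQ (g n) = 0
    rw [Submodule.mkQ_apply, Submodule.Quotient.mk_eq_zero,
      ← homogComponent_sum_of_mem (fun n _ ↦ hg n) hn]
    exact hP n h
  · obtain ⟨m, rfl⟩ := P.mkQ_surjective m
    obtain ⟨F, -, hF⟩ := exists_sum_homogComponent ℳ m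
    exact ⟨F, fun n ↦ P.mkQ (homogComponent ℳ n m),
      fun n ↦ ⟨_, homogComponent_mem ℳ n m, rfl⟩, by rw [← map_sum, hF]⟩

end SubQuot

section KerRange

variable {ℳ : ι → AddSubgroup M} [DirectSum.Decomposition ℳ]
  {𝒩 : ι → AddSubgroup N} [DirectSum.Decomposition 𝒩]
  {φ : M →ₗ[R] N} (hφ : ∀ n, ∀ m ∈ ℳ n, φ m ∈ 𝒩 n)
include hφ

lemma isHomogeneous_ker : (LinearMap.ker φ).IsHomogeneous ℳ := fun n m hm ↦ by
  have := map_homogComponent ℳ 𝒩 φ.toAddMonoidHom Function.injective_id hφ n m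
  rw [LinearMap.mem_ker] at hm
  exact this.trans (by simp [hm])

lemma isHomogeneous_range : (LinearMap.range φ).IsHomogeneous 𝒩 := by
  rintro n _ ⟨m, rfl⟩
  exact ⟨_, map_homogComponent ℳ 𝒩 φ.toAddMonoidHom Function.injective_id hφ n m⟩

end KerRange

end GradedModules

section GradedAction

variable {R : Type*} [CommRing R] {𝒜 : ℕ → AddSubgroup R}
  {M : Type*} [AddCommGroup M] [Module R M] (ℳ : ℤ → AddSubgroup M)

lemma homogComponent_smul [GradedAction 𝒜 ℳ] [DirectSum.Decomposition ℳ] {i : ℕ} {r : R}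
    (hr : r ∈ 𝒜 i) (n : ℤ) (m : M) :
    homogComponent ℳ (i + n) (r • m) = r • homogComponent ℳ n m :=
  (map_homogComponent ℳ ℳ (DistribSMul.toAddMonoidHom M r) (add_right_injective (i : ℤ))
    (fun _ _ hm ↦ GradedAction.smul_mem hr hm) n m).symm

instance [GradedAction 𝒜 ℳ] (d : ℤ) : GradedAction 𝒜 (shiftGrading ℳ d) where
  smul_mem {i n r m} hr hm := by
    have := GradedAction.smul_mem (ℳ := ℳ) hr hm
    rwa [add_left_comm] at this

instance {κ : Type*} {P : κ → Type*} [∀ k, AddCommGroup (P k)] [∀ k, Module R (P k)]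
    (𝒢 : ∀ k, ℤ → AddSubgroup (P k)) [∀ k, GradedAction 𝒜 (𝒢 k)] :
    GradedAction 𝒜 (piGrading 𝒢) where
  smul_mem hr hm := mem_piGrading.2 fun k ↦ GradedAction.smul_mem hr (mem_piGrading.1 hm k)

instance [GradedAction 𝒜 ℳ] (P : Submodule R M) : GradedAction 𝒜 (subGrading ℳ P) where
  smul_mem hr hm := GradedAction.smul_mem (ℳ := ℳ) hr hm

instance [GradedAction 𝒜 ℳ] (P : Submodule R M) : GradedAction 𝒜 (quotGrading ℳ P) where
  smul_mem := by
    rintro i n r _ hr ⟨m, hm, rfl⟩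
    exact ⟨r • m, GradedAction.smul_mem hr hm, map_smul P.mkQ r m⟩

end GradedAction

/-! ### Homogeneous localization -/

namespace Cech

section Localization

variable {R : Type*} [CommRing R] {S : Submonoid R}
  {M N P : Type*} [AddCommGroup M] [Module R M] [AddCommGroup N] [Module R N]
  [AddCommGroup P] [Module R P]

lemma mk_eq_zero_iff {m : M} {s : S} :
    LocalizedModule.mk m s = 0 ↔ ∃ u : S, u • m = 0 := by
  rw [← LocalizedModule.zero_mk 1, LocalizedModule.mk_eq]
  simp

lemma mk_sum {ι : Type*} (F : Finset ι) (f : ι → M) (s : S) :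
    LocalizedModule.mk (∑ k ∈ F, f k) s = ∑ k ∈ F, LocalizedModule.mk (f k) s := by
  induction F using Finset.cons_induction with
  | empty => exact LocalizedModule.zero_mk s
  | cons k F hk ih =>
    rw [Finset.sum_cons, Finset.sum_cons, ← ih]
    simp only [IsLocalizedModule.mk_eq_mk', IsLocalizedModule.mk'_add]

variable (S) in
/-- The map `S⁻¹M → S⁻¹N` induced by a linear map `M → N`. -/
noncomputable abbrev locMap :
    (M →ₗ[R] N) →ₗ[R] LocalizedModule S M →ₗ[R] LocalizedModule S N :=
  IsLocalizedModule.map S (LocalizedModule.mkLinearMap S M) (LocalizedModule.mkLinearMap S N)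

lemma locMap_mk (φ : M →ₗ[R] N) (m : M) (s : S) :
    locMap S φ (LocalizedModule.mk m s) = LocalizedModule.mk (φ m) s :=
  IsLocalizedModule.map_LocalizedModules S φ m s

lemma locMap_locMap (φ : M →ₗ[R] N) (ψ : N →ₗ[R] P) (z : LocalizedModule S M) :
    locMap S ψ (locMap S φ z) = locMap S (ψ ∘ₗ φ) z := by
  induction z using LocalizedModule.induction_on with
  | _ m s => simp only [locMap_mk, LinearMap.comp_apply]

variable {𝒜 : ℕ → AddSubgroup R} [GradedRing 𝒜]
  {ℳ : ℤ → AddSubgroup M} [GradedAction 𝒜 ℳ] {𝒩 : ℤ → AddSubgroup N} [GradedAction 𝒜 𝒩]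

lemma smul_mem_locComponent {i : ℕ} {r : R} (hr : r ∈ 𝒜 i) {n : ℤ} {z : LocalizedModule S M}
    (hz : z ∈ locComponent 𝒜 ℳ S n) : r • z ∈ locComponent 𝒜 ℳ S (i + n) := by
  obtain ⟨e, m, s, hs, hm, rfl⟩ := hz
  refine ⟨e, r • m, s, hs, ?_, LocalizedModule.smul'_mk r m s⟩
  rw [add_left_comm]
  exact GradedAction.smul_mem hr hm

lemma locMap_mem_locComponent {φ : M →ₗ[R] N} (hφ : ∀ n, ∀ m ∈ ℳ n, φ m ∈ 𝒩 n) {n : ℤ}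
    {z : LocalizedModule S M} (hz : z ∈ locComponent 𝒜 ℳ S n) :
    locMap S φ z ∈ locComponent 𝒜 𝒩 S n := by
  obtain ⟨e, m, s, hs, hm, rfl⟩ := hz
  exact ⟨e, φ m, s, hs, hφ _ m hm, locMap_mk φ m s⟩

variable (𝒜 ℳ S) in
lemma locComponent_shiftGrading (d n : ℤ) :
    locComponent 𝒜 (shiftGrading ℳ d) S n = locComponent 𝒜 ℳ S (d + n) := by
  ext z
  simp only [locComponent, shiftGrading, ← AddSubgroup.mem_carrier, Set.mem_ofPred_eq,
    add_left_comm d]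

lemma exists_common_denom (F : Finset ℤ) (f : ℤ → LocalizedModule S M)
    (hf : ∀ n, f n ∈ locComponent 𝒜 ℳ S n) :
    ∃ (e : ℕ) (s : S), (s : R) ∈ 𝒜 e ∧ ∀ n ∈ F, ∃ m ∈ ℳ (e + n), f n = LocalizedModule.mk m s := by
  induction F using Finset.induction_on with
  | empty => exact ⟨0, 1, SetLike.GradedOne.one_mem, by simp⟩
  | insert k F _ ih =>
    obtain ⟨e, s, hs, h⟩ := ih
    obtain ⟨e', m, t, ht, hm, hk⟩ := hf k
    refine ⟨e + e', s * t, SetLike.GradedMul.mul_mem hs ht, fun n hn ↦ ?_⟩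
    push_cast
    rcases Finset.mem_insert.1 hn with rfl | hn
    · refine ⟨s • m, ?_, by rw [hk, LocalizedModule.mk_cancel_common_left]⟩
      rw [add_assoc]
      exact GradedAction.smul_mem (ℳ := ℳ) hs hm
    · obtain ⟨m', hm', h'⟩ := h n hn
      refine ⟨t • m', ?_, by rw [h', LocalizedModule.mk_cancel_common_right]⟩
      rw [add_right_comm, add_comm]
      exact GradedAction.smul_mem (ℳ := ℳ) ht hm'

section Internal

variable [DirectSum.Decomposition ℳ] (hS : ∀ s ∈ S, SetLike.IsHomogeneousElem 𝒜 s)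
include hS

omit [GradedRing 𝒜] in
lemma eq_zero_of_sum_mk_eq_zero {e : ℕ} {s : S} {F : Finset ℤ} {m : ℤ → M}
    (hm : ∀ n ∈ F, m n ∈ ℳ (e + n)) (h : ∑ n ∈ F, LocalizedModule.mk (m n) s = 0) {k : ℤ}
    (hk : k ∈ F) : LocalizedModule.mk (m k) s = 0 := by
  rw [← mk_sum, mk_eq_zero_iff] at h
  obtain ⟨u, hu⟩ := h
  obtain ⟨i, hi⟩ := hS u u.2
  refine mk_eq_zero_iff.2 ⟨u, ?_⟩
  have hmk : homogComponent ℳ (e + k) (∑ n ∈ F, m n) = m k := by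
    rw [map_sum, Finset.sum_eq_single_of_mem k hk fun n hn hnk ↦
      homogComponent_of_mem_ne (hm n hn) (by simpa using hnk), homogComponent_of_mem (hm k hk)]
  calc (u : R) • m k
      = homogComponent ℳ (i + (e + k)) ((u : R) • ∑ n ∈ F, m n) := by
        rw [homogComponent_smul ℳ hi, hmk]
    _ = 0 := by rw [show (u : R) • ∑ n ∈ F, m n = 0 from hu, map_zero]

variable (ℳ)

lemma isInternal_locComponent : DirectSum.IsInternal (locComponent 𝒜 ℳ S) := by
  refine isInternal_of_forall_sum _ (fun F f hf h k hk ↦ ?_) fun z ↦ ?_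
  · obtain ⟨e, s, -, hm⟩ := exists_common_denom F f hf
    choose! m hm hfm using hm
    rw [hfm k hk]
    exact eq_zero_of_sum_mk_eq_zero hS hm (Finset.sum_congr rfl hfm ▸ h) hk
  · induction z using LocalizedModule.induction_on with
    | _ m s =>
      obtain ⟨e, he⟩ := hS s s.2
      obtain ⟨F, -, hF⟩ := exists_sum_homogComponent ℳ m
      refine ⟨F.map (Equiv.addLeft (-(e : ℤ))).toEmbedding,
        fun n ↦ LocalizedModule.mk (homogComponent ℳ (e + n) m) s,
        fun n ↦ ⟨e, _, s, he, homogComponent_mem ℳ _ m, rfl⟩, ?_⟩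
      conv_rhs => rw [← hF, mk_sum]
      simp

end Internal

end Localization

/-! ### Functoriality of the Čech complex -/

section Total

variable {R : Type*} [CommRing R] {r : ℕ} (x : Fin r → R)
  {M N P : Type*} [AddCommGroup M] [Module R M] [AddCommGroup N] [Module R N]
  [AddCommGroup P] [Module R P]

lemma d_apply (c : Total x M) (J : Finset (Fin r)) : d x M c J =
    ∑ j ∈ J, sign R J j • res x M (J.erase_subset j) (c (J.erase j)) := by
  simp [d]

lemma res_mk {I J : Finset (Fin r)} (h : I ⊆ J) (m : M) (s : denom x I) :
    res x M h (LocalizedModule.mk m s) =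
      LocalizedModule.mk m (⟨(s : R), denom_mono x h s.2⟩ : denom x J) := by
  simp only [IsLocalizedModule.mk_eq_mk', IsLocalizedModule.liftOfLE_mk', res]

/-- The map of total Čech modules induced by a linear map. -/
noncomputable def map : (M →ₗ[R] N) →ₗ[R] Total x M →ₗ[R] Total x N where
  toFun φ := LinearMap.pi fun I ↦ locMap (denom x I) φ ∘ₗ LinearMap.proj I
  map_add' φ ψ := by ext; simp
  map_smul' a φ := by ext; simp

lemma map_apply (φ : M →ₗ[R] N) (c : Total x M) (I : Finset (Fin r)) :
    map x φ c I = locMap (denom x I) φ (c I) := rfl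

lemma map_map (φ : M →ₗ[R] N) (ψ : N →ₗ[R] P) (c : Total x M) :
    map x ψ (map x φ c) = map x (ψ ∘ₗ φ) c :=
  funext fun _ ↦ locMap_locMap φ ψ _

lemma map_id (c : Total x M) : map x LinearMap.id c = c :=
  funext fun _ ↦ by rw [map_apply, locMap, IsLocalizedModule.map_id, LinearMap.id_apply]

lemma map_d (φ : M →ₗ[R] N) (c : Total x M) : map x φ (d x M c) = d x N (map x φ c) := by
  have locMap_res {I J : Finset (Fin r)} (h : I ⊆ J) (z : LocalizedModule (denom x I) M) :
      locMap (denom x J) φ (res x M h z) = res x N h (locMap (denom x I) φ z) := by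
    induction z using LocalizedModule.induction_on with
    | _ m s => simp only [res_mk, locMap_mk]
  funext J
  simp only [map_apply, d_apply, map_sum, map_smul, locMap_res]

lemma map_injective {φ : M →ₗ[R] N} (h : Function.Injective φ) :
    Function.Injective (map x φ) := fun _ _ hab ↦ funext fun I ↦
  IsLocalizedModule.map_injective (denom x I) _ _ φ h (congrFun hab I)

end Total

/-! ### Homogeneous cochains -/

section Homogeneous

variable {R : Type*} [CommRing R] {r : ℕ} (x : Fin r → R)
  (𝒜 : ℕ → AddSubgroup R) [GradedRing 𝒜]
  {M N : Type*} [AddCommGroup M] [Module R M] [AddCommGroup N] [Module R N]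
  (ℳ : ℤ → AddSubgroup M) [GradedAction 𝒜 ℳ] (𝒩 : ℤ → AddSubgroup N) [GradedAction 𝒜 𝒩]

/-- The Čech `p`-cochains that are homogeneous of degree `n`. The cohomological degree `p` is an
integer so that the complex needs no special treatment at its left end. -/
def homogCochains (p n : ℤ) : AddSubgroup (Total x M) where
  carrier := {c | (∀ I, (I.card : ℤ) ≠ p → c I = 0) ∧ c ∈ totalComponent x 𝒜 ℳ n}
  zero_mem' := ⟨fun _ _ ↦ rfl, zero_mem _⟩
  add_mem' ha hb := ⟨fun I hI ↦ by simp [ha.1 I hI, hb.1 I hI], add_mem ha.2 hb.2⟩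
  neg_mem' ha := ⟨fun I hI ↦ by simp [ha.1 I hI], neg_mem ha.2⟩

/-- The Čech `p`-cocycles that are homogeneous of degree `n`. -/
noncomputable def homogCocycles (p n : ℤ) : AddSubgroup (Total x M) :=
  homogCochains x 𝒜 ℳ p n ⊓ (d x M).toAddMonoidHom.ker

/-- The coboundaries of the Čech `(p-1)`-cochains that are homogeneous of degree `n`. -/
noncomputable def homogCoboundaries (p n : ℤ) : AddSubgroup (Total x M) :=
  (homogCochains x 𝒜 ℳ (p - 1) n).map (d x M).toAddMonoidHom

/-- The vanishing of the component of degree `n` of the `p`-th Čech cohomology. -/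
def VanishesAt (p n : ℤ) : Prop :=
  homogCocycles x 𝒜 ℳ p n ≤ homogCoboundaries x 𝒜 ℳ p n

variable {x 𝒜 ℳ 𝒩} {p n : ℤ}

lemma mem_totalComponent {c : Total x M} :
    c ∈ totalComponent x 𝒜 ℳ n ↔ ∀ I, c I ∈ locComponent 𝒜 ℳ (denom x I) n :=
  mem_piGrading (𝒢 := fun I ↦ locComponent 𝒜 ℳ (denom x I))

lemma mem_homogCochains {c : Total x M} : c ∈ homogCochains x 𝒜 ℳ p n ↔
    (∀ I, (I.card : ℤ) ≠ p → c I = 0) ∧ c ∈ totalComponent x 𝒜 ℳ n := Iff.rfl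

lemma mem_homogCocycles {c : Total x M} :
    c ∈ homogCocycles x 𝒜 ℳ p n ↔ c ∈ homogCochains x 𝒜 ℳ p n ∧ d x M c = 0 := Iff.rfl

lemma mem_homogCoboundaries {c : Total x M} : c ∈ homogCoboundaries x 𝒜 ℳ p n ↔
    ∃ b ∈ homogCochains x 𝒜 ℳ (p - 1) n, d x M b = c := Iff.rfl

lemma mem_homogCoboundaries_succ {c : Total x M} : c ∈ homogCoboundaries x 𝒜 ℳ (p + 1) n ↔
    ∃ b ∈ homogCochains x 𝒜 ℳ p n, d x M b = c := by
  rw [mem_homogCoboundaries, add_sub_cancel_right]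

lemma exists_mem_homogCochains_of_forall
    {Q : ∀ I : Finset (Fin r), LocalizedModule (denom x I) M → Prop}
    (h : ∀ I, ∃ z ∈ locComponent 𝒜 ℳ (denom x I) n, Q I z)
    (h₀ : ∀ I, (I.card : ℤ) ≠ p → Q I 0) :
    ∃ c ∈ homogCochains x 𝒜 ℳ p n, ∀ I, Q I (c I) := by
  have key I : ∃ z ∈ locComponent 𝒜 ℳ (denom x I) n, ((I.card : ℤ) ≠ p → z = 0) ∧ Q I z := by
    by_cases hI : (I.card : ℤ) = p
    · obtain ⟨z, hz, hQ⟩ := h I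
      exact ⟨z, hz, fun h ↦ absurd hI h, hQ⟩
    · exact ⟨0, zero_mem _, fun _ ↦ rfl, h₀ I hI⟩
  choose c hc hc₀ hQ using key
  exact ⟨c, ⟨hc₀, mem_totalComponent.2 hc⟩, hQ⟩

lemma smul_mem_homogCochains {i : ℕ} {a : R} (ha : a ∈ 𝒜 i) {c : Total x M}
    (hc : c ∈ homogCochains x 𝒜 ℳ p n) : a • c ∈ homogCochains x 𝒜 ℳ p (i + n) :=
  ⟨fun I hI ↦ by rw [Pi.smul_apply, hc.1 I hI, smul_zero],
    mem_totalComponent.2 fun I ↦ smul_mem_locComponent ha (mem_totalComponent.1 hc.2 I)⟩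

lemma smul_mem_homogCocycles {i : ℕ} {a : R} (ha : a ∈ 𝒜 i) {c : Total x M}
    (hc : c ∈ homogCocycles x 𝒜 ℳ p n) : a • c ∈ homogCocycles x 𝒜 ℳ p (i + n) := by
  rw [mem_homogCocycles] at hc ⊢
  exact ⟨smul_mem_homogCochains ha hc.1, by rw [map_smul, hc.2, smul_zero]⟩

lemma d_mem_totalComponent {c : Total x M} (hc : c ∈ totalComponent x 𝒜 ℳ n) :
    d x M c ∈ totalComponent x 𝒜 ℳ n := by
  rw [mem_totalComponent] at hc ⊢
  intro J
  rw [d_apply]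
  refine sum_mem fun j _ ↦ ?_
  have hres : res x M (J.erase_subset j) (c (J.erase j)) ∈ locComponent 𝒜 ℳ (denom x J) n := by
    obtain ⟨e, m, s, hs, hm, h⟩ := hc (J.erase j)
    exact ⟨e, m, ⟨s, denom_mono x (J.erase_subset j) s.2⟩, hs, hm, by rw [h, res_mk]⟩
  rcases neg_one_pow_eq_or R (J.filter (· < j)).card with h | h <;> simpa [sign, h] using hres

lemma d_mem_homogCochains {c : Total x M} (hc : c ∈ homogCochains x 𝒜 ℳ p n) :
    d x M c ∈ homogCochains x 𝒜 ℳ (p + 1) n := by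
  refine ⟨fun J hJ ↦ ?_, d_mem_totalComponent hc.2⟩
  rw [d_apply]
  refine Finset.sum_eq_zero fun j hj ↦ ?_
  have := Finset.card_erase_add_one hj
  rw [hc.1 _ (by omega), map_zero, smul_zero]

section Shift

variable (x 𝒜 ℳ) (δ p n)

lemma homogCochains_shiftGrading :
    homogCochains x 𝒜 (shiftGrading ℳ δ) p n = homogCochains x 𝒜 ℳ p (δ + n) := by
  ext c
  simp only [mem_homogCochains, mem_totalComponent, locComponent_shiftGrading]

lemma homogCoboundaries_shiftGrading :
    homogCoboundaries x 𝒜 (shiftGrading ℳ δ) p n = homogCoboundaries x 𝒜 ℳ p (δ + n) := by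
  rw [homogCoboundaries, homogCochains_shiftGrading, homogCoboundaries]

variable {x 𝒜 ℳ δ p n}

lemma vanishesAt_shiftGrading :
    VanishesAt x 𝒜 (shiftGrading ℳ δ) p n ↔ VanishesAt x 𝒜 ℳ p (δ + n) := by
  rw [VanishesAt, homogCocycles, homogCochains_shiftGrading, homogCoboundaries_shiftGrading]
  rfl

end Shift

section Map

variable {φ : M →ₗ[R] N} (hφ : ∀ n, ∀ m ∈ ℳ n, φ m ∈ 𝒩 n) {c : Total x M}
include hφ

lemma map_mem_homogCochains (hc : c ∈ homogCochains x 𝒜 ℳ p n) :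
    map x φ c ∈ homogCochains x 𝒜 𝒩 p n :=
  ⟨fun I hI ↦ by rw [map_apply, hc.1 I hI, map_zero], mem_totalComponent.2 fun I ↦
    locMap_mem_locComponent hφ (mem_totalComponent.1 hc.2 I)⟩

lemma map_mem_homogCocycles (hc : c ∈ homogCocycles x 𝒜 ℳ p n) :
    map x φ c ∈ homogCocycles x 𝒜 𝒩 p n := by
  rw [mem_homogCocycles] at hc ⊢
  exact ⟨map_mem_homogCochains hφ hc.1, by rw [← map_d, hc.2, map_zero]⟩

lemma map_mem_homogCoboundaries (hc : c ∈ homogCoboundaries x 𝒜 ℳ p n) :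
    map x φ c ∈ homogCoboundaries x 𝒜 𝒩 p n := by
  obtain ⟨b, hb, rfl⟩ := mem_homogCoboundaries.1 hc
  exact ⟨map x φ b, map_mem_homogCochains hφ hb, (map_d x φ b).symm⟩

end Map

end Homogeneous

end Cech

/-! ### The long exact sequence -/

/-- A short exact sequence `0 → L → M → N → 0` of graded modules and maps of degree zero. -/
structure IsGradedShortExact {ι R L M N : Type*} [CommRing R] [AddCommGroup L] [Module R L]
    [AddCommGroup M] [Module R M] [AddCommGroup N] [Module R N] (ℒ : ι → AddSubgroup L)
    (ℳ : ι → AddSubgroup M) (𝒩 : ι → AddSubgroup N) (φ : L →ₗ[R] M) (ψ : M →ₗ[R] N) : Prop where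
  injective : Function.Injective φ
  map_mem_left : ∀ n, ∀ l ∈ ℒ n, φ l ∈ ℳ n
  map_mem_right : ∀ n, ∀ m ∈ ℳ n, ψ m ∈ 𝒩 n
  comp_eq_zero : ψ ∘ₗ φ = 0
  exists_of_map_eq_zero : ∀ n, ∀ m ∈ ℳ n, ψ m = 0 → ∃ l ∈ ℒ n, φ l = m
  exists_lift : ∀ n, ∀ a ∈ 𝒩 n, ∃ m ∈ ℳ n, ψ m = a

namespace Cech

section LongExactSequence

variable {R : Type*} [CommRing R] {r : ℕ} {x : Fin r → R}
  {𝒜 : ℕ → AddSubgroup R} [GradedRing 𝒜]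
  {L M N : Type*} [AddCommGroup L] [Module R L] [AddCommGroup M] [Module R M]
  [AddCommGroup N] [Module R N]
  {ℒ : ℤ → AddSubgroup L} [GradedAction 𝒜 ℒ] {ℳ : ℤ → AddSubgroup M} [GradedAction 𝒜 ℳ]
  {𝒩 : ℤ → AddSubgroup N} [GradedAction 𝒜 𝒩] {φ : L →ₗ[R] M} {ψ : M →ₗ[R] N} {p n : ℤ}

lemma isHomogeneousElem_of_mem_denom (hx : ∀ i, SetLike.IsHomogeneousElem 𝒜 (x i))
    {I : Finset (Fin r)} {s : R} (hs : s ∈ denom x I) : SetLike.IsHomogeneousElem 𝒜 s := by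
  induction hs using Submonoid.closure_induction with
  | mem s hs =>
    obtain ⟨i, -, rfl⟩ := hs
    exact hx i
  | one => exact SetLike.isHomogeneousElem_one 𝒜
  | mul a b _ _ ha hb => exact ha.mul hb

/-- The relation given by the connecting homomorphism of the long exact sequence: the cocycle `l`
represents the image of the class of the cocycle `c`. -/
def IsConnecting (x : Fin r → R) (𝒜 : ℕ → AddSubgroup R) [GradedRing 𝒜] (ℳ : ℤ → AddSubgroup M)
    [GradedAction 𝒜 ℳ] (φ : L →ₗ[R] M) (ψ : M →ₗ[R] N) (p n : ℤ)
    (c : Total x N) (l : Total x L) : Prop :=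
  ∃ b ∈ homogCochains x 𝒜 ℳ p n, map x ψ b = c ∧ d x M b = map x φ l

lemma IsConnecting.smul {c : Total x N} {l : Total x L}
    (hcl : IsConnecting x 𝒜 ℳ φ ψ p n c l) {i : ℕ} {a : R} (ha : a ∈ 𝒜 i) :
    IsConnecting x 𝒜 ℳ φ ψ p (i + n) (a • c) (a • l) := by
  obtain ⟨b, hb, rfl, hbl⟩ := hcl
  exact ⟨a • b, smul_mem_homogCochains ha hb, map_smul _ a b, by rw [map_smul, map_smul, hbl]⟩

variable (h : IsGradedShortExact ℒ ℳ 𝒩 φ ψ)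
include h

lemma map_map_eq_zero (c : Total x L) : map x ψ (map x φ c) = 0 := by
  rw [map_map, h.comp_eq_zero, map_zero, LinearMap.zero_apply]

omit [GradedAction 𝒜 ℒ] in
lemma exists_lift_homogCochains {c : Total x N} (hc : c ∈ homogCochains x 𝒜 𝒩 p n) :
    ∃ b ∈ homogCochains x 𝒜 ℳ p n, map x ψ b = c := by
  suffices ∃ b ∈ homogCochains x 𝒜 ℳ p n, ∀ I, locMap (denom x I) ψ (b I) = c I from
    this.imp fun b hb ↦ ⟨hb.1, funext hb.2⟩
  refine exists_mem_homogCochains_of_forall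
    (Q := fun I z ↦ locMap (denom x I) ψ z = c I) (fun I ↦ ?_)
    fun I hI ↦ by rw [map_zero, hc.1 I hI]
  obtain ⟨e, a, s, hs, ha, hcI⟩ := mem_totalComponent.1 hc.2 I
  obtain ⟨m, hm, rfl⟩ := h.exists_lift _ a ha
  exact ⟨_, ⟨e, m, s, hs, hm, rfl⟩, by rw [locMap_mk, hcI]⟩

omit [GradedAction 𝒜 ℒ] in
lemma exists_isConnecting_of_map_mem {l : Total x L}
    (hφ : map x φ l ∈ homogCoboundaries x 𝒜 ℳ (p + 1) n) :
    ∃ c ∈ homogCocycles x 𝒜 𝒩 p n, IsConnecting x 𝒜 ℳ φ ψ p n c l := by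
  obtain ⟨b, hb, hbl⟩ := mem_homogCoboundaries_succ.1 hφ
  refine ⟨map x ψ b, mem_homogCocycles.2 ⟨map_mem_homogCochains h.map_mem_right hb, ?_⟩,
    b, hb, rfl, hbl⟩
  rw [← map_d, hbl, map_map_eq_zero h]

omit [GradedAction 𝒜 𝒩] in
lemma exists_cocycle_of_isConnecting {c : Total x N} {l : Total x L}
    (hcl : IsConnecting x 𝒜 ℳ φ ψ p n c l) (hl : l ∈ homogCoboundaries x 𝒜 ℒ (p + 1) n) :
    ∃ m ∈ homogCocycles x 𝒜 ℳ p n, map x ψ m = c := by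
  obtain ⟨b, hb, rfl, hbl⟩ := hcl
  obtain ⟨a, ha, rfl⟩ := mem_homogCoboundaries_succ.1 hl
  refine ⟨b - map x φ a, mem_homogCocycles.2
    ⟨sub_mem hb (map_mem_homogCochains h.map_mem_left ha), ?_⟩, ?_⟩
  · rw [map_sub, hbl, map_d, sub_self]
  · rw [map_sub, map_map_eq_zero h, sub_zero]

lemma mem_homogCoboundaries_of_isConnecting_right (hM : VanishesAt x 𝒜 ℳ p n)
    {c : Total x N} {l : Total x L} (hcl : IsConnecting x 𝒜 ℳ φ ψ p n c l)
    (hl : l ∈ homogCoboundaries x 𝒜 ℒ (p + 1) n) : c ∈ homogCoboundaries x 𝒜 𝒩 p n := by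
  obtain ⟨m, hm, rfl⟩ := exists_cocycle_of_isConnecting h hcl hl
  exact map_mem_homogCoboundaries h.map_mem_right (hM hm)

variable (hx : ∀ i, SetLike.IsHomogeneousElem 𝒜 (x i))
include hx

omit [GradedAction 𝒜 𝒩] in
lemma exists_of_map_eq_zero_homogCochains {c : Total x M} (hc : c ∈ homogCochains x 𝒜 ℳ p n)
    (hψ : map x ψ c = 0) : ∃ b ∈ homogCochains x 𝒜 ℒ p n, map x φ b = c := by
  suffices ∃ b ∈ homogCochains x 𝒜 ℒ p n, ∀ I, locMap (denom x I) φ (b I) = c I from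
    this.imp fun b hb ↦ ⟨hb.1, funext hb.2⟩
  refine exists_mem_homogCochains_of_forall
    (Q := fun I z ↦ locMap (denom x I) φ z = c I) (fun I ↦ ?_)
    fun I hI ↦ by rw [map_zero, hc.1 I hI]
  obtain ⟨e, m, s, hs, hm, hcI⟩ := mem_totalComponent.1 hc.2 I
  have hψI := congrFun hψ I
  rw [map_apply, hcI, locMap_mk, Pi.zero_apply, mk_eq_zero_iff] at hψI
  obtain ⟨u, hu⟩ := hψI
  obtain ⟨k, hk⟩ := isHomogeneousElem_of_mem_denom hx u.2
  obtain ⟨l, hl, hlm⟩ := h.exists_of_map_eq_zero _ _ (GradedAction.smul_mem hk hm)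
    (by rw [map_smul]; exact hu)
  refine ⟨_, ⟨k + e, l, u * s, SetLike.GradedMul.mul_mem hk hs, ?_, rfl⟩, ?_⟩
  · rwa [Nat.cast_add, add_assoc]
  · rw [locMap_mk, hcI, hlm]
    exact LocalizedModule.mk_cancel_common_left u s m

lemma mem_homogCoboundaries_of_map (hL : VanishesAt x 𝒜 ℒ p n) {c : Total x M}
    (hc : c ∈ homogCocycles x 𝒜 ℳ p n) (hψ : map x ψ c ∈ homogCoboundaries x 𝒜 𝒩 p n) :
    c ∈ homogCoboundaries x 𝒜 ℳ p n := by
  rw [mem_homogCocycles] at hc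
  obtain ⟨_, hb, hbc⟩ := mem_homogCoboundaries.1 hψ
  obtain ⟨b, hb', rfl⟩ := exists_lift_homogCochains h hb
  have hdb : d x M b ∈ homogCochains x 𝒜 ℳ p n := by simpa using d_mem_homogCochains hb'
  obtain ⟨l, hl, hlc⟩ := exists_of_map_eq_zero_homogCochains h hx (sub_mem hc.1 hdb)
    (by rw [map_sub, map_d, hbc, sub_self])
  have hdl : d x L l = 0 := map_injective x h.injective <| by
    rw [map_d, hlc, map_sub, d_d, hc.2, sub_zero, map_zero]
  have hφl := map_mem_homogCoboundaries h.map_mem_left (hL (mem_homogCocycles.2 ⟨hl, hdl⟩))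
  rw [hlc] at hφl
  simpa using add_mem hφl (mem_homogCoboundaries.2 ⟨b, hb', rfl⟩)

lemma exists_isConnecting {c : Total x N} (hc : c ∈ homogCocycles x 𝒜 𝒩 p n) :
    ∃ l ∈ homogCocycles x 𝒜 ℒ (p + 1) n, IsConnecting x 𝒜 ℳ φ ψ p n c l := by
  rw [mem_homogCocycles] at hc
  obtain ⟨b, hb, rfl⟩ := exists_lift_homogCochains h hc.1
  obtain ⟨l, hl, hlb⟩ := exists_of_map_eq_zero_homogCochains h hx (d_mem_homogCochains hb)
    (by rw [map_d, hc.2])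
  refine ⟨l, mem_homogCocycles.2 ⟨hl, map_injective x h.injective ?_⟩, b, hb, rfl, hlb.symm⟩
  rw [map_d, hlb, d_d, map_zero]

lemma mem_homogCoboundaries_of_isConnecting_left {c : Total x N} {l : Total x L}
    (hcl : IsConnecting x 𝒜 ℳ φ ψ p n c l) (hc : c ∈ homogCoboundaries x 𝒜 𝒩 p n) :
    l ∈ homogCoboundaries x 𝒜 ℒ (p + 1) n := by
  obtain ⟨b, hb, rfl, hbl⟩ := hcl
  obtain ⟨_, ha, hab⟩ := mem_homogCoboundaries.1 hc
  obtain ⟨a, ha', rfl⟩ := exists_lift_homogCochains h ha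
  have hda : d x M a ∈ homogCochains x 𝒜 ℳ p n := by simpa using d_mem_homogCochains ha'
  obtain ⟨e, he, hea⟩ := exists_of_map_eq_zero_homogCochains h hx (sub_mem hb hda)
    (by rw [map_sub, map_d, hab, sub_self])
  refine mem_homogCoboundaries_succ.2 ⟨e, he, map_injective x h.injective ?_⟩
  rw [map_d, hea, map_sub, d_d, sub_zero, hbl]

lemma exists_cocycle_lift (hL : VanishesAt x 𝒜 ℒ (p + 1) n) {c : Total x N}
    (hc : c ∈ homogCocycles x 𝒜 𝒩 p n) : ∃ m ∈ homogCocycles x 𝒜 ℳ p n, map x ψ m = c := by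
  obtain ⟨l, hl, hcl⟩ := exists_isConnecting h hx hc
  exact exists_cocycle_of_isConnecting h hcl (hL hl)

lemma vanishesAt_right (hL : VanishesAt x 𝒜 ℒ (p + 1) n) (hM : VanishesAt x 𝒜 ℳ p n) :
    VanishesAt x 𝒜 𝒩 p n := fun _ hc ↦ by
  obtain ⟨m, hm, rfl⟩ := exists_cocycle_lift h hx hL hc
  exact map_mem_homogCoboundaries h.map_mem_right (hM hm)

end LongExactSequence

section KernelCokernel

variable {R : Type*} [CommRing R] {r : ℕ} {x : Fin r → R}
  {M N : Type*} [AddCommGroup M] [Module R M] [AddCommGroup N] [Module R N]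

lemma isGradedShortExact_ker {ι : Type*} [DecidableEq ι] {ℳ : ι → AddSubgroup M}
    {𝒩 : ι → AddSubgroup N} [DirectSum.Decomposition ℳ] [DirectSum.Decomposition 𝒩]
    {φ : M →ₗ[R] N} (hφ : ∀ n, ∀ m ∈ ℳ n, φ m ∈ 𝒩 n) :
    IsGradedShortExact (subGrading ℳ (LinearMap.ker φ)) ℳ (subGrading 𝒩 (LinearMap.range φ))
      (LinearMap.ker φ).subtype φ.rangeRestrict where
  injective := Subtype.val_injective
  map_mem_left _ _ hl := hl
  map_mem_right n m hm := hφ n m hm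
  comp_eq_zero := LinearMap.ext fun m ↦ Subtype.ext m.2
  exists_of_map_eq_zero n m hm h := ⟨⟨m, congrArg Subtype.val h⟩, hm, rfl⟩
  exists_lift := by
    rintro n ⟨_, m, rfl⟩ hm
    exact ⟨homogComponent ℳ n m, homogComponent_mem ℳ n m, Subtype.ext <|
      (map_homogComponent ℳ 𝒩 φ.toAddMonoidHom Function.injective_id hφ n m).trans
        (homogComponent_of_mem hm)⟩

lemma isGradedShortExact_mkQ {ι : Type*} (𝒩 : ι → AddSubgroup N) (P : Submodule R N) :
    IsGradedShortExact (subGrading 𝒩 P) 𝒩 (quotGrading 𝒩 P) P.subtype P.mkQ where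
  injective := Subtype.val_injective
  map_mem_left _ _ hl := hl
  map_mem_right n m hm := ⟨m, hm, rfl⟩
  comp_eq_zero := LinearMap.ext fun m ↦ by simp
  exists_of_map_eq_zero n m hm h := ⟨⟨m, by simpa using h⟩, hm, rfl⟩
  exists_lift _ _ := id

lemma map_subtype_map_rangeRestrict (φ : M →ₗ[R] N) (c : Total x M) :
    map x (LinearMap.range φ).subtype (map x φ.rangeRestrict c) = map x φ c := by
  rw [map_map]
  rfl

lemma mem_homogCoboundaries_of_map_of_ker_of_coker {𝒜 : ℕ → AddSubgroup R} [GradedRing 𝒜]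
    {ℳ : ℤ → AddSubgroup M} [GradedAction 𝒜 ℳ] [DirectSum.Decomposition ℳ]
    {𝒩 : ℤ → AddSubgroup N} [GradedAction 𝒜 𝒩] [DirectSum.Decomposition 𝒩]
    {φ : M →ₗ[R] N} (hφ : ∀ n, ∀ m ∈ ℳ n, φ m ∈ 𝒩 n)
    (hx : ∀ i, SetLike.IsHomogeneousElem 𝒜 (x i)) {p n : ℤ}
    (hT : VanishesAt x 𝒜 (subGrading ℳ (LinearMap.ker φ)) p n)
    (hC : VanishesAt x 𝒜 (quotGrading 𝒩 (LinearMap.range φ)) (p - 1) n)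
    {c : Total x M} (hc : c ∈ homogCocycles x 𝒜 ℳ p n)
    (hφc : map x φ c ∈ homogCoboundaries x 𝒜 𝒩 p n) : c ∈ homogCoboundaries x 𝒜 ℳ p n := by
  obtain ⟨p, rfl⟩ : ∃ q, p = q + 1 := ⟨p - 1, by ring⟩
  rw [add_sub_cancel_right] at hC
  have hQ := isGradedShortExact_mkQ 𝒩 (LinearMap.range φ)
  refine mem_homogCoboundaries_of_map (isGradedShortExact_ker hφ) hx hT hc ?_
  rw [← map_subtype_map_rangeRestrict] at hφc
  obtain ⟨a, ha, hal⟩ := exists_isConnecting_of_map_mem hQ hφc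
  exact mem_homogCoboundaries_of_isConnecting_left hQ hx hal (hC ha)

end KernelCokernel

end Cech

/-! ### Homogeneous components of local cohomology -/

namespace Cech

section Component

variable {R : Type*} [CommRing R] {r : ℕ} {x : Fin r → R} {M : Type*} [AddCommGroup M] [Module R M]

lemma mem_coboundaries_iff {p : ℕ} {c : Total x M} : c ∈ coboundaries x M p ↔
    ∃ b : Total x M, (∀ I, I.card + 1 ≠ p → b I = 0) ∧ d x M b = c := by
  cases p with
  | zero =>
    refine ⟨fun hc ↦ ⟨0, fun _ _ ↦ rfl, by rw [map_zero, (Submodule.mem_bot R).1 hc]⟩, ?_⟩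
    rintro ⟨b, hb, rfl⟩
    obtain rfl : b = 0 := funext fun I ↦ hb I (Nat.succ_ne_zero _)
    rw [map_zero]
    exact zero_mem _
  | succ p => simp [coboundaries, cochains]

variable {𝒜 : ℕ → AddSubgroup R} [GradedRing 𝒜] {ℳ : ℤ → AddSubgroup M} [GradedAction 𝒜 ℳ]

lemma mem_homogCocycles_natCast_iff {p : ℕ} {n : ℤ} {c : Total x M} :
    c ∈ homogCocycles x 𝒜 ℳ p n ↔ c ∈ cocycles x M p ∧ c ∈ totalComponent x 𝒜 ℳ n := by
  rw [mem_homogCocycles, mem_homogCochains, cocycles, Submodule.mem_inf, LinearMap.mem_ker]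
  simp only [Nat.cast_inj, ne_eq]
  exact and_right_comm

lemma mem_coboundaries_of_mem_homogCoboundaries {p : ℕ} {n : ℤ} {c : Total x M}
    (hc : c ∈ homogCoboundaries x 𝒜 ℳ p n) : c ∈ coboundaries x M p := by
  obtain ⟨b, hb, rfl⟩ := mem_homogCoboundaries.1 hc
  exact mem_coboundaries_iff.2 ⟨b, fun I hI ↦ hb.1 I (by omega), rfl⟩

section Decomposition

variable [DirectSum.Decomposition (totalComponent x 𝒜 ℳ)]

lemma d_homogComponent (n : ℤ) (c : Total x M) :
    d x M (homogComponent (totalComponent x 𝒜 ℳ) n c) =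
      homogComponent (totalComponent x 𝒜 ℳ) n (d x M c) :=
  map_homogComponent _ _ (d x M).toAddMonoidHom Function.injective_id
    (fun _ _ ↦ d_mem_totalComponent) n c

lemma homogComponent_mem_homogCochains {p : ℤ} {c : Total x M}
    (hc : ∀ I, (I.card : ℤ) ≠ p → c I = 0) (n : ℤ) :
    homogComponent (totalComponent x 𝒜 ℳ) n c ∈ homogCochains x 𝒜 ℳ p n := by
  refine ⟨fun I hI ↦ ?_, homogComponent_mem _ n c⟩
  let restrict : Total x M →+ Total x M := (AddMonoidHom.single _ I).comp (Pi.evalAddMonoidHom _ I)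
  have restrict_mem (k : ℤ) (b : Total x M) (hb : b ∈ totalComponent x 𝒜 ℳ k) :
      restrict b ∈ totalComponent x 𝒜 ℳ k := by
    refine mem_totalComponent.2 fun J ↦ ?_
    rcases eq_or_ne J I with rfl | hJ
    · simpa [restrict] using mem_totalComponent.1 hb J
    · simp [restrict, hJ]
  have h := map_homogComponent _ (totalComponent x 𝒜 ℳ) restrict Function.injective_id
    restrict_mem n c
  simpa [restrict, hc I hI] using congrFun h I

end Decomposition

variable [DirectSum.Decomposition ℳ] (hx : ∀ i, SetLike.IsHomogeneousElem 𝒜 (x i))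
include hx

variable (ℳ) in
lemma isInternal_totalComponent : DirectSum.IsInternal (totalComponent x 𝒜 ℳ) :=
  let _ (I : Finset (Fin r)) : DirectSum.Decomposition (locComponent 𝒜 ℳ (denom x I)) :=
    (isInternal_locComponent ℳ fun _ ↦ isHomogeneousElem_of_mem_denom hx).chooseDecomposition
  DirectSum.Decomposition.isInternal (piGrading fun I ↦ locComponent 𝒜 ℳ (denom x I))

lemma mem_homogCoboundaries_of_mem_coboundaries {p : ℕ} {n : ℤ} {c : Total x M}
    (hc : c ∈ coboundaries x M p) (hn : c ∈ totalComponent x 𝒜 ℳ n) :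
    c ∈ homogCoboundaries x 𝒜 ℳ p n := by
  let _ := (isInternal_totalComponent ℳ hx).chooseDecomposition
  obtain ⟨b, hb, rfl⟩ := mem_coboundaries_iff.1 hc
  refine mem_homogCoboundaries.2 ⟨homogComponent (totalComponent x 𝒜 ℳ) n b,
    homogComponent_mem_homogCochains (fun I hI ↦ hb I (by omega)) n, ?_⟩
  rw [d_homogComponent, homogComponent_of_mem hn]

lemma exists_sum_homogCocycles {p : ℕ} {c : Total x M} (hc : c ∈ cocycles x M p) :
    ∃ (F : Finset ℤ) (f : ℤ → Total x M), (∀ n, f n ∈ homogCocycles x 𝒜 ℳ p n) ∧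
      ∑ n ∈ F, f n = c := by
  let _ := (isInternal_totalComponent ℳ hx).chooseDecomposition
  obtain ⟨F, -, hF⟩ := exists_sum_homogComponent (totalComponent x 𝒜 ℳ) c
  refine ⟨F, fun n ↦ homogComponent (totalComponent x 𝒜 ℳ) n c, fun n ↦ ?_, hF⟩
  exact mem_homogCocycles.2
    ⟨homogComponent_mem_homogCochains (fun I hI ↦ hc.1 I (by omega)) n, by
      rw [d_homogComponent, LinearMap.mem_ker.1 hc.2, map_zero]⟩

variable (ℳ)

lemma component_eq_bot_iff (p : ℕ) (n : ℤ) :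
    component x 𝒜 ℳ p n = ⊥ ↔ VanishesAt x 𝒜 ℳ p n := by
  rw [component, eq_bot_iff]
  constructor
  · intro h c hc
    obtain ⟨hc, hn⟩ := mem_homogCocycles_natCast_iff.1 hc
    have hc₀ : (Submodule.Quotient.mk ⟨c, hc⟩ : H x M p) = 0 :=
      AddSubgroup.mem_bot.1 (h ⟨⟨c, hc⟩, hn, rfl⟩)
    rw [Submodule.Quotient.mk_eq_zero] at hc₀
    exact mem_homogCoboundaries_of_mem_coboundaries hx hc₀ hn
  · rintro h _ ⟨⟨c, hc⟩, hn, rfl⟩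
    exact AddSubgroup.mem_bot.2 ((Submodule.Quotient.mk_eq_zero _).2
      (mem_coboundaries_of_mem_homogCoboundaries (h (mem_homogCocycles_natCast_iff.2 ⟨hc, hn⟩))))

end Component

section Bounded

variable {R : Type*} [CommRing R] {𝒜 : ℕ → AddSubgroup R} [GradedRing 𝒜]
  {M : Type*} [AddCommGroup M] [Module R M] {ℳ : ℤ → AddSubgroup M} [GradedAction 𝒜 ℳ]
  (hM : (HomogeneousIdeal.irrelevant 𝒜).toIdeal ≤ Module.annihilator R M)
include hM

omit [GradedAction 𝒜 ℳ] in
lemma smul_eq_zero_of_irrelevant_le_annihilator {i : ℕ} (hi : i ≠ 0) {a : R} (ha : a ∈ 𝒜 i)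
    (m : M) : a • m = 0 :=
  Module.mem_annihilator.1 (hM (HomogeneousIdeal.mem_irrelevant_of_mem 𝒜
    (Nat.pos_of_ne_zero hi) ha)) m

lemma vanishesAt_of_grading_eq_bot {r : ℕ} {x : Fin r → R} {n : ℤ} (hn : ℳ n = ⊥) (p : ℤ) :
    VanishesAt x 𝒜 ℳ p n := by
  intro c hc
  suffices c = 0 from this ▸ zero_mem _
  funext I
  obtain ⟨e, m, s, hs, hm, h⟩ := mem_totalComponent.1 hc.1.2 I
  rw [h, Pi.zero_apply, mk_eq_zero_iff]
  refine ⟨s, ?_⟩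
  rcases eq_or_ne e 0 with rfl | he
  · obtain rfl : m = 0 := by simpa [hn] using hm
    exact smul_zero s
  · exact smul_eq_zero_of_irrelevant_le_annihilator hM he hs m

variable [DirectSum.Decomposition ℳ]

lemma grading_eq_bot_of_span_eq_top {G : Set M} (hG : Submodule.span R G = ⊤) {n : ℤ}
    (hn : ∀ g ∈ G, homogComponent ℳ n g = 0) : ℳ n = ⊥ := by
  refine (AddSubgroup.eq_bot_iff_forall _).2 fun m hm ↦ ?_
  rw [← homogComponent_of_mem hm]
  clear hm
  induction hG ▸ Submodule.mem_top (x := m) using Submodule.span_induction with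
  | mem g hg => exact hn g hg
  | zero => exact map_zero _
  | add a b _ _ ha hb => rw [map_add, ha, hb, add_zero]
  | smul a m _ hm =>
    induction a using DirectSum.Decomposition.inductionOn 𝒜 with
    | zero => rw [zero_smul, map_zero]
    | @homogeneous i a =>
      rcases eq_or_ne i 0 with rfl | hi
      · simpa [hm] using homogComponent_smul ℳ a.2 n m
      · rw [smul_eq_zero_of_irrelevant_le_annihilator hM hi a.2, map_zero]
    | add a b ha hb => rw [add_smul, map_add, ha, hb, add_zero]

lemma finite_setOf_grading_ne_bot [Module.Finite R M] : {n | ℳ n ≠ ⊥}.Finite := by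
  classical
  obtain ⟨G, hG⟩ := Module.Finite.fg_top (R := R) (M := M)
  choose F hF _ using exists_sum_homogComponent ℳ
  refine (G.biUnion F).finite_toSet.subset fun n hn ↦ by_contra fun hnF ↦ hn ?_
  exact grading_eq_bot_of_span_eq_top hM hG fun g hg ↦
    hF g n fun h ↦ hnF (Finset.mem_coe.2 (Finset.mem_biUnion.2 ⟨g, hg, h⟩))

lemma eventually_cofinite_vanishesAt [Module.Finite R M] {r : ℕ} (x : Fin r → R) (p : ℤ) :
    ∀ᶠ n in Filter.cofinite, VanishesAt x 𝒜 ℳ p n := by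
  filter_upwards [(finite_setOf_grading_ne_bot (ℳ := ℳ) hM).eventually_cofinite_notMem] with n hn
  exact vanishesAt_of_grading_eq_bot hM (not_not.1 hn) p

end Bounded

/-! ### Torsion of local cohomology -/

section Torsion

variable {R : Type*} [CommRing R] {r : ℕ} {x : Fin r → R} {M : Type*} [AddCommGroup M] [Module R M]
  {I : Finset (Fin r)} {j : Fin r}

lemma exists_eq_pow_mul_of_mem_denom_insert {s : R} (hs : s ∈ denom x (insert j I)) :
    ∃ (k : ℕ) (t : denom x I), s = x j ^ k * t := by
  induction hs using Submonoid.closure_induction with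
  | mem s hs =>
    obtain ⟨i, hi, rfl⟩ := hs
    rcases Finset.mem_insert.1 hi with rfl | hi
    · exact ⟨1, 1, by simp⟩
    · exact ⟨0, ⟨x i, Submonoid.subset_closure ⟨i, hi, rfl⟩⟩, by simp⟩
  | one => exact ⟨0, 1, by simp⟩
  | mul a b _ _ ha hb =>
    obtain ⟨k, t, rfl⟩ := ha
    obtain ⟨k', t', rfl⟩ := hb
    exact ⟨k + k', t * t', by rw [pow_add, Submonoid.coe_mul]; ring⟩

lemma eventually_exists_res_eq_pow_smul (z : LocalizedModule (denom x (insert j I)) M) :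
    ∀ᶠ k in Filter.atTop, ∃ w, res x M (I.subset_insert j) w = x j ^ k • z := by
  induction z using LocalizedModule.induction_on with
  | _ m s =>
    obtain ⟨k, t, hs⟩ := exists_eq_pow_mul_of_mem_denom_insert s.2
    have hxk : x j ^ k ∈ denom x (insert j I) :=
      pow_mem (Submonoid.subset_closure (Set.mem_image_of_mem x (I.mem_insert_self j))) k
    obtain rfl : s = ⟨x j ^ k, hxk⟩ * ⟨t, denom_mono x (I.subset_insert j) t.2⟩ :=
      Subtype.ext hs
    filter_upwards [Filter.eventually_ge_atTop k] with l hl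
    refine ⟨x j ^ (l - k) • LocalizedModule.mk m t, ?_⟩
    rw [map_smul, res_mk, ← pow_sub_mul_pow (x j) hl, mul_smul,
      LocalizedModule.smul'_mk (x j ^ k)]
    congr 1
    exact (LocalizedModule.mk_cancel_common_left
      (⟨x j ^ k, hxk⟩ : denom x (insert j I)) _ m).symm

lemma eventually_pow_smul_eq_zero_of_res_eq_zero {w : LocalizedModule (denom x I) M}
    (hw : res x M (I.subset_insert j) w = 0) : ∀ᶠ k in Filter.atTop, x j ^ k • w = 0 := by
  induction w using LocalizedModule.induction_on with
  | _ m s =>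
    rw [res_mk, mk_eq_zero_iff] at hw
    obtain ⟨u, hu⟩ := hw
    obtain ⟨k, t, hut⟩ := exists_eq_pow_mul_of_mem_denom_insert u.2
    have hm : (t : R) • x j ^ k • m = 0 := by
      rw [smul_smul, mul_comm, ← hut]
      exact hu
    have hk : x j ^ k • LocalizedModule.mk m s = 0 := by
      rw [LocalizedModule.smul'_mk, mk_eq_zero_iff]
      exact ⟨t, hm⟩
    filter_upwards [Filter.eventually_ge_atTop k] with l hl
    rw [← pow_sub_mul_pow (x j) hl, mul_smul, hk, smul_zero]

lemma sign_smul_sign_smul (J : Finset (Fin r)) (j : Fin r) {A : Type*} [AddCommGroup A]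
    [Module R A] (a : A) : sign R J j • sign R J j • a = a := by
  rw [smul_smul, sign, ← mul_pow]
  simp

lemma d_apply_insert {c : Total x M} (hc : ∀ I, j ∈ I → c I = 0) (hj : j ∉ I) :
    d x M c (insert j I) = sign R (insert j I) j • res x M (I.subset_insert j) (c I) := by
  have res_congr {I' : Finset (Fin r)} (e : I' = I) (h : I' ⊆ insert j I) :
      res x M h (c I') = res x M (I.subset_insert j) (c I) := by
    subst e
    rfl
  rw [d_apply, Finset.sum_eq_single_of_mem j (I.mem_insert_self j),
    res_congr (Finset.erase_insert hj)]
  intro i _ hij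
  rw [hc _ (Finset.mem_erase.2 ⟨hij.symm, I.mem_insert_self j⟩), map_zero, smul_zero]

variable (j) in
lemma exists_d_eq_pow_smul_of_mem {p : ℕ} {c : Total x M} (hc : ∀ I, I.card ≠ p → c I = 0) :
    ∃ (k : ℕ) (b : Total x M), (∀ I, I.card + 1 ≠ p → b I = 0) ∧
      ∀ J, j ∈ J → d x M b J = x j ^ k • c J := by
  obtain ⟨k, hk⟩ := (Filter.eventually_all.2 fun I ↦
    eventually_exists_res_eq_pow_smul (x := x) (j := j) (I := I) (c (insert j I))).exists
  have exists_primitive (I : Finset (Fin r)) : ∃ w : LocalizedModule (denom x I) M,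
      (j ∈ I → w = 0) ∧ (I.card + 1 ≠ p → w = 0) ∧ (j ∉ I → res x M (I.subset_insert j) w =
        sign R (insert j I) j • x j ^ k • c (insert j I)) := by
    by_cases hj : j ∈ I
    · exact ⟨0, fun _ ↦ rfl, fun _ ↦ rfl, fun h ↦ absurd hj h⟩
    by_cases hp : I.card + 1 = p
    · obtain ⟨w, hw⟩ := hk I
      exact ⟨sign R (insert j I) j • w, fun h ↦ absurd h hj, fun h ↦ absurd hp h,
        fun _ ↦ by rw [map_smul, hw]⟩
    · exact ⟨0, fun _ ↦ rfl, fun _ ↦ rfl, fun _ ↦ by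
        rw [hc _ (by rwa [Finset.card_insert_of_notMem hj]), smul_zero, smul_zero, map_zero]⟩
  choose b hbj hbp hb using exists_primitive
  refine ⟨k, b, hbp, fun J hJ ↦ ?_⟩
  obtain ⟨I, hI, rfl⟩ : ∃ I, j ∉ I ∧ insert j I = J :=
    ⟨J.erase j, J.notMem_erase j, Finset.insert_erase hJ⟩
  rw [d_apply_insert hbj hI, hb I hI, sign_smul_sign_smul]

lemma exists_pow_smul_eq_zero_of_d_eq_zero {e : Total x M} (he : ∀ I, j ∈ I → e I = 0)
    (hde : d x M e = 0) : ∃ k : ℕ, x j ^ k • e = 0 := by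
  have torsion (I : Finset (Fin r)) : ∀ᶠ k in Filter.atTop, x j ^ k • e I = 0 := by
    by_cases hI : j ∈ I
    · simp [he I hI]
    refine eventually_pow_smul_eq_zero_of_res_eq_zero (j := j) ?_
    rw [← sign_smul_sign_smul (R := R) (insert j I) j (res x M _ _), ← d_apply_insert he hI,
      hde, Pi.zero_apply, smul_zero]
  obtain ⟨k, hk⟩ := (Filter.eventually_all.2 torsion).exists
  exact ⟨k, funext hk⟩

lemma exists_pow_smul_generator_mem_coboundaries {p : ℕ} {c : Total x M}
    (hc : c ∈ cocycles x M p) (j : Fin r) : ∃ k : ℕ, x j ^ k • c ∈ coboundaries x M p := by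
  obtain ⟨k, b, hbp, hb⟩ := exists_d_eq_pow_smul_of_mem j hc.1
  obtain ⟨l, hl⟩ := exists_pow_smul_eq_zero_of_d_eq_zero (e := d x M b - x j ^ k • c) (j := j)
    (fun I hI ↦ by rw [Pi.sub_apply, Pi.smul_apply, hb I hI, sub_self])
    (by rw [map_sub, map_smul, d_d, LinearMap.mem_ker.1 hc.2, smul_zero, sub_zero])
  refine ⟨l + k, mem_coboundaries_iff.2
    ⟨x j ^ l • b, fun I hI ↦ by rw [Pi.smul_apply, hbp I hI, smul_zero], ?_⟩⟩
  rw [smul_sub, sub_eq_zero] at hl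
  rw [map_smul, hl, smul_smul, pow_add]

lemma exists_pow_smul_mem_coboundaries {p : ℕ} {c : Total x M} (hc : c ∈ cocycles x M p) {a : R}
    (ha : a ∈ (Ideal.span (Set.range x)).radical) : ∃ k : ℕ, a ^ k • c ∈ coboundaries x M p := by
  let Q : Ideal R := (coboundaries x M p).comap (LinearMap.toSpanSingleton R (Total x M) c)
  suffices Ideal.span (Set.range x) ≤ Q.radical from Ideal.radical_le_radical_iff.2 this ha
  rw [Ideal.span_le]
  rintro _ ⟨j, rfl⟩
  exact exists_pow_smul_generator_mem_coboundaries hc j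

end Torsion

section HomogeneousTorsion

variable {R : Type*} [CommRing R] {r : ℕ} {x : Fin r → R} {𝒜 : ℕ → AddSubgroup R} [GradedRing 𝒜]
  {M : Type*} [AddCommGroup M] [Module R M] {ℳ : ℤ → AddSubgroup M} [GradedAction 𝒜 ℳ] {p n : ℤ}

lemma vanishesAt_of_neg (hp : p < 0) : VanishesAt x 𝒜 ℳ p n := by
  intro c hc
  obtain rfl : c = 0 := funext fun I ↦ hc.1.1 I (by omega)
  exact zero_mem _

lemma exists_pow_smul_mem_homogCoboundaries [DirectSum.Decomposition ℳ]
    (hx : ∀ i, SetLike.IsHomogeneousElem 𝒜 (x i)) {c : Total x M}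
    (hc : c ∈ homogCocycles x 𝒜 ℳ p n) {i : ℕ} {a : R} (ha : a ∈ 𝒜 i)
    (hax : a ∈ (Ideal.span (Set.range x)).radical) :
    ∃ k : ℕ, a ^ k • c ∈ homogCoboundaries x 𝒜 ℳ p ((k * i : ℕ) + n) := by
  rcases lt_or_ge p 0 with hp | hp
  · exact ⟨0, by simpa using vanishesAt_of_neg hp hc⟩
  lift p to ℕ using hp
  obtain ⟨k, hk⟩ := exists_pow_smul_mem_coboundaries (mem_homogCocycles_natCast_iff.1 hc).1 hax
  have hck := smul_mem_homogCocycles (SetLike.pow_mem_graded k ha) hc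
  exact ⟨k, mem_homogCoboundaries_of_mem_coboundaries hx hk hck.1.2⟩

end HomogeneousTorsion

end Cech

/-! ### Multiplication by a family of homogeneous elements -/

namespace Cech

section Pi

variable {R : Type*} [CommRing R] {r : ℕ} {x : Fin r → R} {𝒜 : ℕ → AddSubgroup R} [GradedRing 𝒜]
  {κ : Type*} [Finite κ] {N : κ → Type*} [∀ k, AddCommGroup (N k)] [∀ k, Module R (N k)]
  {𝒩 : ∀ k, ℤ → AddSubgroup (N k)} [∀ k, GradedAction 𝒜 (𝒩 k)] {p n : ℤ}

lemma mem_homogCoboundaries_piGrading_iff {c : Total x (∀ k, N k)} :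
    c ∈ homogCoboundaries x 𝒜 (piGrading 𝒩) p n ↔
      ∀ k, map x (LinearMap.proj k) c ∈ homogCoboundaries x 𝒜 (𝒩 k) p n := by
  classical
  have := Fintype.ofFinite κ
  refine ⟨fun hc k ↦ map_mem_homogCoboundaries (fun _ _ hf ↦ mem_piGrading.1 hf k) hc,
    fun hc ↦ ?_⟩
  have single_mem (k : κ) (n : ℤ) (m : N k) (hm : m ∈ 𝒩 k n) :
      LinearMap.single R N k m ∈ piGrading 𝒩 n := by
    refine mem_piGrading.2 fun j ↦ ?_
    rcases eq_or_ne j k with rfl | hj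
    · simpa using hm
    · simp [hj]
  have sum_single_proj : ∑ k, LinearMap.single R N k ∘ₗ LinearMap.proj k = LinearMap.id := by
    ext k m j
    simp
  rw [← map_id x c, ← sum_single_proj, map_sum, LinearMap.sum_apply]
  refine sum_mem fun k _ ↦ ?_
  rw [← map_map]
  exact map_mem_homogCoboundaries (single_mem k) (hc k)

lemma vanishesAt_piGrading (h : ∀ k, VanishesAt x 𝒜 (𝒩 k) p n) :
    VanishesAt x 𝒜 (piGrading 𝒩) p n := fun _ hc ↦
  mem_homogCoboundaries_piGrading_iff.2 fun k ↦
    h k (map_mem_homogCocycles (fun _ _ hf ↦ mem_piGrading.1 hf k) hc)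

end Pi

section MulFamily

variable {R : Type*} [CommRing R] {r : ℕ} {x : Fin r → R} {𝒜 : ℕ → AddSubgroup R} [GradedRing 𝒜]
  {M : Type*} [AddCommGroup M] [Module R M] {ℳ : ℤ → AddSubgroup M} [GradedAction 𝒜 ℳ] {p n : ℤ}

lemma map_smul_id (a : R) (c : Total x M) : map x (a • LinearMap.id) c = a • c := by
  rw [map_smul, LinearMap.smul_apply, map_id]

variable {κ : Type*} {y : κ → R} {δ : κ → ℕ}

variable (M y) in
/-- The map `m ↦ (yₖ m)ₖ`. -/
def mulFamily : M →ₗ[R] κ → M :=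
  LinearMap.pi fun k ↦ y k • LinearMap.id

variable (ℳ δ) in
/-- The grading of `∏ₖ M(δₖ)`, for which `mulFamily M y` has degree zero when each `yₖ` is
homogeneous of degree `δₖ`. -/
def piShiftGrading : ℤ → AddSubgroup (κ → M) :=
  piGrading fun k ↦ shiftGrading ℳ (δ k)

instance : GradedAction 𝒜 (piShiftGrading ℳ δ) :=
  inferInstanceAs (GradedAction 𝒜 (piGrading fun k ↦ shiftGrading ℳ (δ k)))

noncomputable instance [Finite κ] [DirectSum.Decomposition ℳ] :
    DirectSum.Decomposition (piShiftGrading ℳ δ) :=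
  inferInstanceAs (DirectSum.Decomposition (piGrading fun k ↦ shiftGrading ℳ (δ k)))

omit [GradedRing 𝒜] in
lemma mulFamily_mem (hy : ∀ k, y k ∈ 𝒜 (δ k)) (n : ℤ) (m : M) (hm : m ∈ ℳ n) :
    mulFamily M y m ∈ piShiftGrading ℳ δ n :=
  mem_piGrading.2 fun k ↦ GradedAction.smul_mem (hy k) hm

variable [Finite κ]

lemma vanishesAt_piShiftGrading (h : ∀ k, VanishesAt x 𝒜 ℳ p (δ k + n)) :
    VanishesAt x 𝒜 (piShiftGrading ℳ δ) p n :=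
  vanishesAt_piGrading fun k ↦ vanishesAt_shiftGrading.2 (h k)

lemma map_mulFamily_mem_homogCoboundaries_iff {c : Total x M} :
    map x (mulFamily M y) c ∈ homogCoboundaries x 𝒜 (piShiftGrading ℳ δ) p n ↔
      ∀ k, y k • c ∈ homogCoboundaries x 𝒜 ℳ p (δ k + n) := by
  refine mem_homogCoboundaries_piGrading_iff.trans (forall_congr' fun k ↦ ?_)
  rw [map_map, homogCoboundaries_shiftGrading, ← map_smul_id]
  rfl

/-- By the long exact sequences of the kernel and cokernel, a class of the cokernel comes from a
class of `M` whose products with all `yₖ` vanish. -/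
lemma smul_mem_homogCoboundaries_coker [DirectSum.Decomposition ℳ] (hy : ∀ k, y k ∈ 𝒜 (δ k))
    (hx : ∀ i, SetLike.IsHomogeneousElem 𝒜 (x i))
    (hT : VanishesAt x 𝒜 (subGrading ℳ (LinearMap.ker (mulFamily M y))) (p + 1 + 1) n) {k : κ}
    (hM : VanishesAt x 𝒜 (piShiftGrading ℳ δ) p (δ k + n))
    {c : Total x ((κ → M) ⧸ LinearMap.range (mulFamily M y))}
    (hc : c ∈ homogCocycles x 𝒜
      (quotGrading (piShiftGrading ℳ δ) (LinearMap.range (mulFamily M y))) p n) :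
    y k • c ∈ homogCoboundaries x 𝒜
      (quotGrading (piShiftGrading ℳ δ) (LinearMap.range (mulFamily M y))) p (δ k + n) := by
  have hK := isGradedShortExact_ker (mulFamily_mem (ℳ := ℳ) hy)
  have hQ := isGradedShortExact_mkQ (piShiftGrading ℳ δ) (LinearMap.range (mulFamily M y))
  obtain ⟨l, hl, hcl⟩ := exists_isConnecting hQ hx hc
  obtain ⟨m, -, rfl⟩ := exists_cocycle_lift hK hx hT hl
  have hφm : map x (mulFamily M y) m ∈
      homogCoboundaries x 𝒜 (piShiftGrading ℳ δ) (p + 1) n := by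
    obtain ⟨b, hb, -, hbm⟩ := hcl
    exact mem_homogCoboundaries_succ.2 ⟨b, hb, by rw [hbm, map_subtype_map_rangeRestrict]⟩
  have hyl := map_mem_homogCoboundaries hK.map_mem_right
    (map_mulFamily_mem_homogCoboundaries_iff.1 hφm k)
  rw [map_smul] at hyl
  exact mem_homogCoboundaries_of_isConnecting_right hQ hM (hcl.smul (hy k)) hyl

end MulFamily

end Cech

namespace Cech

open Filter

universe u v

variable {R : Type u} [CommRing R] {r : ℕ} {x : Fin r → R} {𝒜 : ℕ → AddSubgroup R} [GradedRing 𝒜]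

/-! ### Vanishing in large degrees -/

section AtTop

variable (hx : ∀ i, SetLike.IsHomogeneousElem 𝒜 (x i))
include hx

section Multiplication

variable {M : Type*} [AddCommGroup M] [Module R M] {ℳ : ℤ → AddSubgroup M} [GradedAction 𝒜 ℳ]
  [DirectSum.Decomposition ℳ] {p : ℤ} {i : ℕ} {a : R} (ha : a ∈ 𝒜 i)
  (hax : a ∈ (Ideal.span (Set.range x)).radical)
include ha hax

lemma eventually_atTop_vanishesAt_of_smul_injective
    (hinj : ∀ᶠ n in atTop, ∀ c ∈ homogCocycles x 𝒜 ℳ p n,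
      a • c ∈ homogCoboundaries x 𝒜 ℳ p (i + n) → c ∈ homogCoboundaries x 𝒜 ℳ p n) :
    ∀ᶠ n in atTop, VanishesAt x 𝒜 ℳ p n := by
  obtain ⟨N, hN⟩ := eventually_atTop.1 hinj
  have pow_injective (k : ℕ) : ∀ n ≥ N, ∀ c ∈ homogCocycles x 𝒜 ℳ p n,
      a ^ k • c ∈ homogCoboundaries x 𝒜 ℳ p ((k * i : ℕ) + n) →
        c ∈ homogCoboundaries x 𝒜 ℳ p n := by
    induction k with
    | zero => simp
    | succ k ih =>
      intro n hn c hc hac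
      refine hN n hn c hc (ih (i + n) (by omega) _ (smul_mem_homogCocycles ha hc) ?_)
      rw [smul_smul, ← pow_succ, ← add_assoc]
      exact_mod_cast Nat.succ_mul k i ▸ hac
  filter_upwards [eventually_ge_atTop N] with n hn c hc
  obtain ⟨k, hk⟩ := exists_pow_smul_mem_homogCoboundaries hx hc ha hax
  exact pow_injective k n hn c hc hk

lemma eventually_atTop_vanishesAt_of_ker_of_coker
    (hT : ∀ᶠ n in atTop,
      VanishesAt x 𝒜 (subGrading ℳ (LinearMap.ker (a • LinearMap.id : M →ₗ[R] M))) p n)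
    (hC : ∀ᶠ n in atTop, VanishesAt x 𝒜 (quotGrading (shiftGrading ℳ i)
      (LinearMap.range (a • LinearMap.id : M →ₗ[R] M))) (p - 1) n) :
    ∀ᶠ n in atTop, VanishesAt x 𝒜 ℳ p n := by
  refine eventually_atTop_vanishesAt_of_smul_injective hx ha hax ?_
  filter_upwards [hT, hC] with n hTn hCn c hc hac
  refine mem_homogCoboundaries_of_map_of_ker_of_coker
    (𝒩 := shiftGrading ℳ i) (fun _ _ ↦ GradedAction.smul_mem ha) hx hTn hCn hc ?_
  rwa [map_smul_id, homogCoboundaries_shiftGrading]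

end Multiplication

variable [IsNoetherianRing R]

/-- Multiplication by `a ∈ S` has kernel and cokernel annihilated by `a`, which lowers the number of
generators of `R₊` still acting; a module on which `R₊` acts by zero is bounded. -/
lemma eventually_atTop_vanishesAt_of_irrelevant_le (S : Finset R)
    (hS : ∀ a ∈ S, SetLike.IsHomogeneousElem 𝒜 a ∧ a ∈ (Ideal.span (Set.range x)).radical) :
    ∀ (M : Type v) [AddCommGroup M] [Module R M] [Module.Finite R M]
      (ℳ : ℤ → AddSubgroup M) [DirectSum.Decomposition ℳ] [GradedAction 𝒜 ℳ],
      (HomogeneousIdeal.irrelevant 𝒜).toIdeal ≤ Ideal.span S ⊔ Module.annihilator R M →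
      ∀ p, ∀ᶠ n in atTop, VanishesAt x 𝒜 ℳ p n := by
  classical
  induction S using Finset.induction_on with
  | empty =>
    intro M _ _ _ ℳ _ _ hM p
    rw [Finset.coe_empty, Ideal.span_empty, bot_sup_eq] at hM
    exact (eventually_cofinite_vanishesAt hM x p).filter_mono atTop_le_cofinite
  | insert a S _ ih =>
    intro M _ _ _ ℳ _ _ hM p
    rw [Finset.forall_mem_insert] at hS
    obtain ⟨⟨⟨i, ha⟩, hax⟩, hS⟩ := hS
    let φ : M →ₗ[R] M := a • LinearMap.id
    have hφ (n : ℤ) : ∀ m ∈ ℳ n, φ m ∈ shiftGrading ℳ i n := fun _ ↦ GradedAction.smul_mem ha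
    let _ := (isInternal_subGrading ℳ (isHomogeneous_ker hφ)).chooseDecomposition
    let _ := (isInternal_quotGrading _ (isHomogeneous_range hφ)).chooseDecomposition
    have irrelevant_le {J : Ideal R} (haJ : a ∈ J) (hJ : Module.annihilator R M ≤ J) :
        (HomogeneousIdeal.irrelevant 𝒜).toIdeal ≤ Ideal.span S ⊔ J := by
      refine hM.trans (sup_le (Ideal.span_le.2 ?_) (hJ.trans le_sup_right))
      rw [Finset.coe_insert]
      exact Set.insert_subset (Ideal.mem_sup_right haJ)
        fun s hs ↦ Ideal.mem_sup_left (Ideal.subset_span hs)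
    refine eventually_atTop_vanishesAt_of_ker_of_coker hx ha hax
      (ih hS (LinearMap.ker φ) (subGrading ℳ _) (irrelevant_le ?_ ?_) p)
      (ih hS (M ⧸ LinearMap.range φ) (quotGrading (shiftGrading ℳ i) _)
        (irrelevant_le ?_ ?_) (p - 1))
    · exact Module.mem_annihilator.2 fun m ↦ Subtype.ext m.2
    · exact LinearMap.annihilator_le_of_injective _ (LinearMap.ker φ).injective_subtype
    · refine Module.mem_annihilator.2 fun m ↦ ?_
      obtain ⟨m, rfl⟩ := (LinearMap.range φ).mkQ_surjective m
      exact (Submodule.Quotient.mk_eq_zero _).2 ⟨m, rfl⟩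
    · exact LinearMap.annihilator_le_of_surjective _ (LinearMap.range φ).mkQ_surjective

lemma eventually_atTop_vanishesAt
    (hirr : (HomogeneousIdeal.irrelevant 𝒜).toIdeal ≤ (Ideal.span (Set.range x)).radical)
    {M : Type*} [AddCommGroup M] [Module R M] [Module.Finite R M]
    (ℳ : ℤ → AddSubgroup M) [DirectSum.Decomposition ℳ] [GradedAction 𝒜 ℳ] (p : ℤ) :
    ∀ᶠ n in atTop, VanishesAt x 𝒜 ℳ p n := by
  have hspan := HomogeneousIdeal.irrelevant_eq_span 𝒜
  obtain ⟨S, hS, hSspan⟩ := (Submodule.fg_span_iff_fg_span_finset_subset _).1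
    (IsNoetherian.noetherian (Ideal.span (⋃ i > 0, (𝒜 i : Set R))))
  refine eventually_atTop_vanishesAt_of_irrelevant_le hx S (fun a ha ↦ ⟨?_, ?_⟩) M ℳ
    ((hspan.trans hSspan).le.trans le_sup_left) p
  · obtain ⟨i, -, hi⟩ := Set.mem_iUnion₂.1 (hS ha)
    exact ⟨i, hi⟩
  · exact hirr (hspan ▸ Ideal.subset_span (hS ha))

end AtTop

/-! ### Socles in small degrees -/

section Socle

variable {M : Type*} [AddCommGroup M] [Module R M] {ℳ : ℤ → AddSubgroup M} [GradedAction 𝒜 ℳ]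
  {κ : Type*} {y : κ → R} {δ : κ → ℕ} {p n : ℤ}

variable (x 𝒜 ℳ y δ p n) in
/-- No non-zero class of degree `n` in the `p`-th Čech cohomology is annihilated by all `yₖ`, where
`yₖ` has degree `δₖ`. -/
def SocleVanishesAt : Prop :=
  ∀ c ∈ homogCocycles x 𝒜 ℳ p n,
    (∀ k, y k • c ∈ homogCoboundaries x 𝒜 ℳ p (δ k + n)) → c ∈ homogCoboundaries x 𝒜 ℳ p n

variable [Finite κ] [DirectSum.Decomposition ℳ] (hy : ∀ k, y k ∈ 𝒜 (δ k))
  (hx : ∀ i, SetLike.IsHomogeneousElem 𝒜 (x i))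
include hy hx

lemma socleVanishesAt_of_ker_of_coker
    (hT : VanishesAt x 𝒜 (subGrading ℳ (LinearMap.ker (mulFamily M y))) p n)
    (hC : VanishesAt x 𝒜
      (quotGrading (piShiftGrading ℳ δ) (LinearMap.range (mulFamily M y))) (p - 1) n) :
    SocleVanishesAt x 𝒜 ℳ y δ p n := fun _ hc hyc ↦
  mem_homogCoboundaries_of_map_of_ker_of_coker (mulFamily_mem hy) hx hT hC hc
    (map_mulFamily_mem_homogCoboundaries_iff.2 hyc)

lemma vanishesAt_coker_of_socleVanishesAt
    (hT : VanishesAt x 𝒜 (subGrading ℳ (LinearMap.ker (mulFamily M y))) (p + 1 + 1) n)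
    (hM : ∀ k, VanishesAt x 𝒜 (piShiftGrading ℳ δ) p (δ k + n))
    (hC : SocleVanishesAt x 𝒜
      (quotGrading (piShiftGrading ℳ δ) (LinearMap.range (mulFamily M y))) y δ p n) :
    VanishesAt x 𝒜 (quotGrading (piShiftGrading ℳ δ) (LinearMap.range (mulFamily M y))) p n :=
  fun c hc ↦ hC c hc fun k ↦ smul_mem_homogCoboundaries_coker hy hx hT (hM k) hc

end Socle

section AtBot

lemma eventually_atBot_natCast_add {P : ℤ → Prop} (h : ∀ᶠ n in atBot, P n) (e : ℕ) :
    ∀ᶠ n in atBot, P (e + n) :=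
  (tendsto_atBot_add_const_left atBot (e : ℤ) tendsto_id).eventually h

variable {M : Type*} [AddCommGroup M] [Module R M] {ℳ : ℤ → AddSubgroup M} [GradedAction 𝒜 ℳ]
  [DirectSum.Decomposition ℳ] {κ : Type*} [Finite κ] {y : κ → R} {δ : κ → ℕ}

omit [DirectSum.Decomposition ℳ] in
lemma eventually_atBot_vanishesAt_piShiftGrading {p : ℤ}
    (hM : ∀ᶠ n in atBot, VanishesAt x 𝒜 ℳ p n) :
    ∀ᶠ n in atBot, VanishesAt x 𝒜 (piShiftGrading ℳ δ) p n := by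
  filter_upwards [eventually_all.2 fun k ↦ eventually_atBot_natCast_add hM (δ k)] with n hn
  exact vanishesAt_piShiftGrading hn

variable [IsNoetherianRing R] [Module.Finite R M] (hy : ∀ k, y k ∈ 𝒜 (δ k))
  (hirr : (HomogeneousIdeal.irrelevant 𝒜).toIdeal ≤ Ideal.span (Set.range y))
include hy hirr

variable (x ℳ) in
lemma eventually_atBot_vanishesAt_ker_mulFamily (p : ℤ) :
    ∀ᶠ n in atBot,
      VanishesAt x 𝒜 (subGrading ℳ (LinearMap.ker (mulFamily M y))) p n := by
  let _ := (isInternal_subGrading ℳ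
    (isHomogeneous_ker (mulFamily_mem (ℳ := ℳ) hy))).chooseDecomposition
  refine (eventually_cofinite_vanishesAt (hirr.trans (Ideal.span_le.2 ?_)) x p).filter_mono
    atBot_le_cofinite
  rintro _ ⟨k, rfl⟩
  exact Module.mem_annihilator.2 fun m ↦ Subtype.ext (congrFun m.2 k)

lemma eventually_atBot_vanishesAt_coker_mulFamily
    (hx : ∀ i, SetLike.IsHomogeneousElem 𝒜 (x i)) {p : ℤ}
    (hp : ∀ᶠ n in atBot, VanishesAt x 𝒜 ℳ p n)
    (hp' : ∀ᶠ n in atBot, VanishesAt x 𝒜 ℳ (p + 1) n) :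
    ∀ᶠ n in atBot, VanishesAt x 𝒜
      (quotGrading (piShiftGrading ℳ δ) (LinearMap.range (mulFamily M y))) p n := by
  filter_upwards [eventually_atBot_vanishesAt_ker_mulFamily x ℳ hy hirr (p + 1 + 1),
    hp', eventually_atBot_vanishesAt_piShiftGrading (δ := δ) hp] with n hTn hMn hNn
  exact vanishesAt_right (isGradedShortExact_mkQ _ _) hx
    (vanishesAt_right (isGradedShortExact_ker (mulFamily_mem hy)) hx hTn hMn) hNn

end AtBot

/-- Induction on `g`: the kernel and cokernel of `M → ∏ₖ M(δₖ)` control the socle of `M` at level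
`g + 1`, and the cokernel satisfies the hypothesis at level `g`. -/
lemma eventually_atBot_socleVanishesAt [IsNoetherianRing R]
    (hx : ∀ i, SetLike.IsHomogeneousElem 𝒜 (x i)) {t : ℕ} {y : Fin t → R} {δ : Fin t → ℕ}
    (hy : ∀ k, y k ∈ 𝒜 (δ k))
    (hirr : (HomogeneousIdeal.irrelevant 𝒜).toIdeal ≤ Ideal.span (Set.range y)) (g : ℕ) :
    ∀ (M : Type v) [AddCommGroup M] [Module R M] [Module.Finite R M]
      (ℳ : ℤ → AddSubgroup M) [DirectSum.Decomposition ℳ] [GradedAction 𝒜 ℳ],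
      (∀ j < g, ∀ᶠ n in atBot, VanishesAt x 𝒜 ℳ j n) →
      ∀ᶠ n in atBot, SocleVanishesAt x 𝒜 ℳ y δ g n := by
  induction g with
  | zero =>
    intro M _ _ _ ℳ _ _ _
    filter_upwards [eventually_atBot_vanishesAt_ker_mulFamily x ℳ hy hirr (0 : ℕ)] with n hTn
    exact socleVanishesAt_of_ker_of_coker hy hx hTn (vanishesAt_of_neg (by simp))
  | succ g ih =>
    intro M _ _ _ ℳ _ _ hM
    let 𝒞 := quotGrading (piShiftGrading ℳ δ) (LinearMap.range (mulFamily M y))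
    let _ : DirectSum.Decomposition 𝒞 :=
      (isInternal_quotGrading _ (isHomogeneous_range (mulFamily_mem hy))).chooseDecomposition
    have hT := eventually_atBot_vanishesAt_ker_mulFamily x ℳ hy hirr
    have hC : ∀ j < g, ∀ᶠ n in atBot, VanishesAt x 𝒜 𝒞 j n := fun j hj ↦
      eventually_atBot_vanishesAt_coker_mulFamily hy hirr hx (hM j (by omega))
        (hM (j + 1) (by omega))
    have hN : ∀ᶠ n in atBot, ∀ k, VanishesAt x 𝒜 (piShiftGrading ℳ δ) g (δ k + n) :=
      eventually_all.2 fun k ↦ eventually_atBot_natCast_add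
        (eventually_atBot_vanishesAt_piShiftGrading (hM g (by omega))) (δ k)
    filter_upwards [hT (g + 1 : ℕ), hT (g + 1 + 1), hN, ih _ 𝒞 hC] with n hTn hTn' hNn hsoc
    refine socleVanishesAt_of_ker_of_coker hy hx hTn ?_
    rw [Nat.cast_succ, add_sub_cancel_right]
    exact vanishesAt_coker_of_socleVanishesAt hy hx hTn' hNn hsoc

end Cech

/-! ### Annihilators of local cohomology -/

namespace Cech

open Filter

section Annihilator

variable {R : Type*} [CommRing R] {r : ℕ} {x : Fin r → R} {𝒜 : ℕ → AddSubgroup R} [GradedRing 𝒜]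
  {M : Type*} [AddCommGroup M] [Module R M] {ℳ : ℤ → AddSubgroup M} [GradedAction 𝒜 ℳ]

lemma smul_mem_coboundaries_of_mem_annihilator {p : ℕ} {a : R}
    (ha : a ∈ Module.annihilator R (H x M p)) {c : Total x M} (hc : c ∈ cocycles x M p) :
    a • c ∈ coboundaries x M p := by
  have h := Module.mem_annihilator.1 ha (Submodule.Quotient.mk ⟨c, hc⟩)
  rwa [← Submodule.Quotient.mk_smul, Submodule.Quotient.mk_eq_zero] at h

lemma mem_annihilator_of_forall_homogCocycles [DirectSum.Decomposition ℳ]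
    (hx : ∀ i, SetLike.IsHomogeneousElem 𝒜 (x i)) {p : ℕ} {a : R}
    (h : ∀ n, ∀ c ∈ homogCocycles x 𝒜 ℳ p n, a • c ∈ coboundaries x M p) :
    a ∈ Module.annihilator R (H x M p) := by
  refine Module.mem_annihilator.2 fun z ↦ ?_
  obtain ⟨⟨c, hc⟩, rfl⟩ := Submodule.Quotient.mk_surjective _ z
  rw [← Submodule.Quotient.mk_smul, Submodule.Quotient.mk_eq_zero]
  change a • c ∈ coboundaries x M p
  obtain ⟨F, f, hf, rfl⟩ := exists_sum_homogCocycles (ℳ := ℳ) hx hc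
  rw [Finset.smul_sum]
  exact sum_mem fun n _ ↦ h n _ (hf n)

lemma irrelevant_le_radical_annihilator [DirectSum.Decomposition ℳ]
    (hx : ∀ i, SetLike.IsHomogeneousElem 𝒜 (x i)) {p : ℕ}
    (htop : ∀ᶠ n in atTop, VanishesAt x 𝒜 ℳ p n) (hbot : ∀ᶠ n in atBot, VanishesAt x 𝒜 ℳ p n) :
    (HomogeneousIdeal.irrelevant 𝒜).toIdeal ≤ (Module.annihilator R (H x M p)).radical := by
  obtain ⟨N, hN⟩ := eventually_atTop.1 htop
  obtain ⟨N', hN'⟩ := eventually_atBot.1 hbot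
  rw [HomogeneousIdeal.irrelevant_eq_span, Ideal.span_le]
  intro a ha
  obtain ⟨i, hi, ha⟩ := Set.mem_iUnion₂.1 ha
  let k := (N - N').toNat
  have hki : N - N' ≤ (k * i : ℕ) :=
    (Int.self_le_toNat _).trans (Nat.cast_le.2 (Nat.le_mul_of_pos_right k hi))
  have hak : a ^ k ∈ 𝒜 (k * i) := SetLike.pow_mem_graded k ha
  refine ⟨k, mem_annihilator_of_forall_homogCocycles (ℳ := ℳ) hx fun n c hc ↦ ?_⟩
  rcases le_total n N' with hn | hn
  · exact Submodule.smul_mem _ _ (mem_coboundaries_of_mem_homogCoboundaries (hN' n hn hc))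
  · exact mem_coboundaries_of_mem_homogCoboundaries
      (hN _ (by omega) (smul_mem_homogCocycles hak hc))

section DegreeOne

variable {κ : Type*} {y : κ → R} (hy : ∀ k, y k ∈ 𝒜 1) {p : ℤ}
include hy

lemma exists_smul_notMem_homogCoboundaries {N : ℤ}
    (hsoc : ∀ n ≤ N, SocleVanishesAt x 𝒜 ℳ y (fun _ ↦ 1) p n) {n : ℤ} {c : Total x M}
    (hc : c ∈ homogCocycles x 𝒜 ℳ p n) (hc' : c ∉ homogCoboundaries x 𝒜 ℳ p n) (k : ℕ)
    (hk : k + n ≤ N + 1) :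
    ∃ a ∈ 𝒜 k, a ∈ (HomogeneousIdeal.irrelevant 𝒜).toIdeal ^ k ∧
      a • c ∉ homogCoboundaries x 𝒜 ℳ p (k + n) := by
  induction k with
  | zero => exact ⟨1, SetLike.GradedOne.one_mem, by simp, by simpa using hc'⟩
  | succ k ih =>
    push_cast at hk
    obtain ⟨a, ha, hak, hac⟩ := ih (by omega)
    obtain ⟨j, hj⟩ : ∃ j, y j • a • c ∉ homogCoboundaries x 𝒜 ℳ p ((1 : ℕ) + (k + n)) := by
      by_contra! h
      exact hac (hsoc _ (by omega) _ (smul_mem_homogCocycles ha hc) h)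
    refine ⟨a * y j, SetLike.GradedMul.mul_mem ha (hy j), ?_, ?_⟩
    · exact Ideal.mul_mem_mul hak (HomogeneousIdeal.mem_irrelevant_of_mem 𝒜 one_pos (hy j))
    · rwa [mul_comm, mul_smul, add_comm k, Nat.cast_add, add_assoc]

variable (hsoc : ∀ᶠ n in atBot, SocleVanishesAt x 𝒜 ℳ y (fun _ ↦ 1) p n)
  (hp : ∃ᶠ n in atBot, ¬ VanishesAt x 𝒜 ℳ p n)
include hsoc hp

lemma exists_forall_exists_smul_notMem_homogCoboundaries :
    ∃ N : ℤ, ∀ m, ∃ n ≤ m, ∃ c ∈ homogCocycles x 𝒜 ℳ p n, ∀ k : ℕ, k + n ≤ N →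
      ∃ a ∈ 𝒜 k, a ∈ (HomogeneousIdeal.irrelevant 𝒜).toIdeal ^ k ∧
        a • c ∉ homogCoboundaries x 𝒜 ℳ p (k + n) := by
  obtain ⟨N, hN⟩ := eventually_atBot.1 hsoc
  refine ⟨N, fun m ↦ ?_⟩
  obtain ⟨n, hn, hV⟩ := frequently_atBot.1 hp m
  obtain ⟨c, hc, hc'⟩ := SetLike.not_le_iff_exists.1 hV
  exact ⟨n, hn, c, hc, fun k hk ↦
    exists_smul_notMem_homogCoboundaries hy hN hc hc' k (by omega)⟩

lemma eventually_atBot_not_vanishesAt : ∀ᶠ n in atBot, ¬ VanishesAt x 𝒜 ℳ p n := by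
  obtain ⟨N, hN⟩ := exists_forall_exists_smul_notMem_homogCoboundaries hy hsoc hp
  filter_upwards [eventually_le_atBot N] with m hm hV
  obtain ⟨n, hn, c, hc, h⟩ := hN m
  obtain ⟨k, rfl⟩ : ∃ k : ℕ, m = k + n := ⟨(m - n).toNat, by omega⟩
  obtain ⟨a, ha, -, hac⟩ := h k hm
  exact hac (hV (smul_mem_homogCocycles ha hc))

end DegreeOne

lemma not_irrelevant_le_radical_annihilator [IsNoetherianRing R] [DirectSum.Decomposition ℳ]
    (hx : ∀ i, SetLike.IsHomogeneousElem 𝒜 (x i)) {κ : Type*} {y : κ → R} (hy : ∀ k, y k ∈ 𝒜 1)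
    {p : ℕ} (hsoc : ∀ᶠ n in atBot, SocleVanishesAt x 𝒜 ℳ y (fun _ ↦ 1) p n)
    (hp : ∃ᶠ n in atBot, ¬ VanishesAt x 𝒜 ℳ p n) :
    ¬ (HomogeneousIdeal.irrelevant 𝒜).toIdeal ≤ (Module.annihilator R (H x M p)).radical := by
  intro hle
  obtain ⟨k, hk⟩ := Ideal.exists_pow_le_of_le_radical_of_fg hle (IsNoetherian.noetherian _)
  obtain ⟨N, hN⟩ := exists_forall_exists_smul_notMem_homogCoboundaries hy hsoc hp
  obtain ⟨n, hn, c, hc, h⟩ := hN (N - k)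
  obtain ⟨a, ha, hak, hac⟩ := h k (by omega)
  exact hac (mem_homogCoboundaries_of_mem_coboundaries hx
    (smul_mem_coboundaries_of_mem_annihilator (hk hak) (mem_homogCocycles_natCast_iff.1 hc).1)
    (smul_mem_homogCocycles ha hc).1.2)

end Annihilator

end Cech

/-! ### Algebras generated in degree one -/

section Generation

variable {R : Type*} [CommRing R] (𝒜 : ℕ → AddSubgroup R) [GradedRing 𝒜]

lemma sub_projZeroRingHom_mem_span {S : Set R} (hS : S ⊆ 𝒜 1) {a : R}
    (ha : a ∈ Algebra.adjoin (𝒜 0) S) : a - GradedRing.projZeroRingHom 𝒜 a ∈ Ideal.span S := by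
  induction ha using Algebra.adjoin_induction with
  | mem s hs =>
    have proj_eq_zero : GradedRing.projZeroRingHom 𝒜 s = 0 :=
      DirectSum.decompose_of_mem_ne 𝒜 (hS hs) one_ne_zero
    rw [proj_eq_zero, sub_zero]
    exact Ideal.subset_span hs
  | algebraMap a =>
    have proj_eq_self : GradedRing.projZeroRingHom 𝒜 (a : R) = a :=
      DirectSum.decompose_of_mem_same 𝒜 a.2
    rw [show algebraMap (𝒜 0) R a = a from rfl, proj_eq_self, sub_self]
    exact zero_mem _
  | add a b _ _ ha hb =>
    rw [map_add, add_sub_add_comm]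
    exact add_mem ha hb
  | mul a b _ _ ha hb =>
    let π := GradedRing.projZeroRingHom 𝒜
    have mul_sub : a * b - π (a * b) = a * (b - π b) + π b * (a - π a) := by rw [map_mul]; ring
    rw [mul_sub]
    exact add_mem (Ideal.mul_mem_left _ _ hb) (Ideal.mul_mem_left _ _ ha)

lemma irrelevant_eq_span_of_adjoin_eq_top {S : Set R} (hS : S ⊆ 𝒜 1)
    (hgen : Algebra.adjoin (𝒜 0) S = ⊤) :
    (HomogeneousIdeal.irrelevant 𝒜).toIdeal = Ideal.span S := by
  refine le_antisymm (fun a ha ↦ ?_) (Ideal.span_le.2 fun s hs ↦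
    HomogeneousIdeal.mem_irrelevant_of_mem 𝒜 one_pos (hS hs))
  have proj_eq_zero : GradedRing.projZeroRingHom 𝒜 a = 0 :=
    (HomogeneousIdeal.mem_irrelevant_iff 𝒜 a).1 ha
  simpa [proj_eq_zero] using sub_projZeroRingHom_mem_span 𝒜 hS (hgen ▸ Algebra.mem_top : a ∈ _)

lemma exists_irrelevant_eq_span_range [IsNoetherianRing R]
    (hgen : Algebra.adjoin (𝒜 0) (𝒜 1 : Set R) = ⊤) :
    ∃ (t : ℕ) (y : Fin t → R), (∀ k, y k ∈ 𝒜 1) ∧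
      (HomogeneousIdeal.irrelevant 𝒜).toIdeal = Ideal.span (Set.range y) := by
  obtain ⟨S, hS, hspan⟩ := (Submodule.fg_span_iff_fg_span_finset_subset _).1
    (IsNoetherian.noetherian (Ideal.span (𝒜 1 : Set R)))
  refine ⟨S.card, fun k ↦ S.equivFin.symm k, fun k ↦ hS (S.equivFin.symm k).2, ?_⟩
  rw [irrelevant_eq_span_of_adjoin_eq_top 𝒜 subset_rfl hgen]
  refine hspan.trans (congrArg _ ?_)
  rw [← Function.comp_def, Set.range_comp, S.equivFin.symm.range_eq_univ, Set.image_univ]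
  exact Subtype.range_coe.symm

end Generation

section Infimum

lemma iInf_natCast_eq_iff_isLeast {s : Set ℕ} {f : ℕ} :
    ⨅ i ∈ s, (i : ℕ∞) = f ↔ IsLeast s f := by
  refine ⟨fun h ↦ ?_, fun h ↦ le_antisymm (iInf₂_le f h.1)
    (le_iInf₂ fun i hi ↦ Nat.cast_le.2 (h.2 hi))⟩
  have hle : f ∈ lowerBounds s := fun i hi ↦ Nat.cast_le.1 (h ▸ iInf₂_le i hi)
  refine ⟨by_contra fun hf ↦ ?_, hle⟩
  have succ_le : ((f + 1 : ℕ) : ℕ∞) ≤ f := h ▸ le_iInf₂ fun i hi ↦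
    Nat.cast_le.2 ((hle hi).lt_of_ne fun hfi ↦ hf (hfi ▸ hi))
  exact (Nat.lt_succ_self f).not_ge (Nat.cast_le.1 succ_le)

lemma iInf_natCast_eq_of_subset {s t : Set ℕ} (hst : s ⊆ t) (h : ∀ g, IsLeast t g → g ∈ s) :
    ⨅ i ∈ s, (i : ℕ∞) = ⨅ i ∈ t, (i : ℕ∞) := by
  rcases t.eq_empty_or_nonempty with rfl | ht
  · rw [Set.subset_empty_iff.1 hst]
  have least : IsLeast t (sInf t) := ⟨Nat.sInf_mem ht, fun _ ↦ Nat.sInf_le⟩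
  rw [iInf_natCast_eq_iff_isLeast.2 least, iInf_natCast_eq_iff_isLeast]
  exact ⟨h _ least, lowerBounds_mono_set hst least.2⟩

end Infimum

theorem proposition2p1_general {R : Type*} [CommRing R] [IsNoetherianRing R]
    (𝒜 : ℕ → AddSubgroup R) [GradedRing 𝒜] (hgen : Algebra.adjoin (𝒜 0) (𝒜 1 : Set R) = ⊤)
    {M : Type*} [AddCommGroup M] [Module R M] [Module.Finite R M]
    (ℳ : ℤ → AddSubgroup M) [DirectSum.Decomposition ℳ] [GradedAction 𝒜 ℳ]
    {r : ℕ} (x : Fin r → R) (hx : ∀ i, SetLike.IsHomogeneousElem 𝒜 (x i))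
    (hirr : (HomogeneousIdeal.irrelevant 𝒜).toIdeal ≤ (Ideal.span (Set.range x)).radical) :
    (∀ f : ℕ, Cech.relFinitenessDim x M 𝒜 = f →
      ∀ᶠ n : ℤ in Filter.atBot, Cech.component x 𝒜 ℳ f n ≠ ⊥) ∧
    Cech.relFinitenessDim x M 𝒜 =
      ⨅ i ∈ {i : ℕ | ∀ᶠ n : ℤ in Filter.atBot, Cech.component x 𝒜 ℳ i n ≠ ⊥}, (i : ℕ∞) := by
  simp only [ne_eq, Cech.component_eq_bot_iff ℳ hx]
  obtain ⟨t, y, hy, hspan⟩ := exists_irrelevant_eq_span_range 𝒜 hgen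
  let T : Set ℕ := {i | ∃ᶠ n in Filter.atBot, ¬ Cech.VanishesAt x 𝒜 ℳ i n}
  have socle (g : ℕ) (hg : IsLeast T g) :
      ∀ᶠ n in Filter.atBot, Cech.SocleVanishesAt x 𝒜 ℳ y (fun _ ↦ 1) g n :=
    Cech.eventually_atBot_socleVanishesAt hx hy hspan.le g M ℳ fun j hj ↦
      by_contra fun h ↦ hj.not_ge (hg.2 (Filter.not_eventually.1 h))
  have eventually_ne (g : ℕ) (hg : IsLeast T g) :=
    Cech.eventually_atBot_not_vanishesAt hy (socle g hg) hg.1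
  have relFinitenessDim_eq : Cech.relFinitenessDim x M 𝒜 = ⨅ i ∈ T, (i : ℕ∞) :=
    iInf_natCast_eq_of_subset
      (fun i hi hbot ↦ hi (Cech.irrelevant_le_radical_annihilator hx
        (Cech.eventually_atTop_vanishesAt hx hirr ℳ i) (by simpa using hbot)))
      fun g hg ↦ Cech.not_irrelevant_le_radical_annihilator hx hy (socle g hg) hg.1
  refine ⟨fun f hf ↦ ?_, relFinitenessDim_eq.trans (iInf_natCast_eq_of_subset
    (fun i hi ↦ Filter.Eventually.frequently hi) eventually_ne).symm⟩
  exact eventually_ne f (iInf_natCast_eq_iff_isLeast.1 (relFinitenessDim_eq.symm.trans hf))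

/-- `H^i_𝔞(M)` is `Cech.H x M i`, graded by `Cech.component x 𝒜 ℳ i`, for an arbitrary system `x`
of homogeneous generators of `𝔞 = 𝔞₀R + R₊`. -/
theorem proposition2p1 {R : Type*} [CommRing R] [IsNoetherianRing R]
    (𝒜 : ℕ → AddSubgroup R) [GradedRing 𝒜]
    [IsNoetherianRing (𝒜 0)] [IsLocalRing (𝒜 0)]
    (hgen : ∃ S : Finset R, (S : Set R) ⊆ 𝒜 1 ∧ Algebra.adjoin (𝒜 0) (S : Set R) = ⊤)
    (a₀ : Ideal (𝒜 0)) (ha₀ : a₀ ≠ ⊤)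
    {M : Type*} [AddCommGroup M] [Module R M] [Module.Finite R M] [Nontrivial M]
    (ℳ : ℤ → AddSubgroup M) [DirectSum.Decomposition ℳ] [GradedAction 𝒜 ℳ]
    {r : ℕ} (x : Fin r → R) (hx : IsHomogeneousGenerators 𝒜 x (idealAddIrrelevant 𝒜 a₀)) :
    (∀ f : ℕ, Cech.relFinitenessDim x M 𝒜 = f →
      ∀ᶠ n : ℤ in Filter.atBot, Cech.component x 𝒜 ℳ f n ≠ ⊥) ∧
    Cech.relFinitenessDim x M 𝒜 =
      ⨅ i ∈ {i : ℕ | ∀ᶠ n : ℤ in Filter.atBot, Cech.component x 𝒜 ℳ i n ≠ ⊥}, (i : ℕ∞) := by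
  obtain ⟨S, hS, hadj⟩ := hgen
  exact proposition2p1_general 𝒜 (top_le_iff.1 (hadj ▸ Algebra.adjoin_mono hS)) ℳ x hx.homogeneous
    (hx.span_eq ▸ le_sup_right.trans Ideal.le_radical)
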